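/- Let $d\ge 1$, $n\ge 1$, $\varepsilon = 1/n$, $D=(0,1)^d$. Divide $\mathbb R^d$ into the closed cubes of side length $\varepsilon$ with vertices in $\varepsilon\mathbb Z^d$, and let $\mathcal T$ be the induced periodic mesh, i.e. these cubes modulo translations by $\mathbb Z^d$. Split $\mathcal T$ into two disjoint subsets $\mathcal T_\alpha$, $\mathcal T_\beta$ with $\mathcal T_\beta\ne\emptyset$, and for real numbers $0\le\alpha\le\beta$ let $V=\alpha$ on the elements of $\mathcal T_\alpha$ and $V=\beta$ on those of $\mathcal T_\beta$. Let $\mathcal V=H^1_{\mathrm{per}}(D)$ be the closure of the smooth $\mathbb Z^d$-periodic functions in the $H^1(D)$-norm, and put $$a(u,v)=\int_D \nabla u\cdot\nabla v+V\,u\,v\,dx,\qquad |||v|||=a(v,v)^{1/2},\qquad \mathcal A:\mathcal V\to\mathcal V^*,\ \langle\mathcal A u,v\rangle=a(u,v).$$ *Geometry.* Let $\mathcal Q$ be the set of cubes (modulo $\mathbb Z^d$) of side length $k\varepsilon$, $1\le k\le n$, that are unions of mesh elements, and let $\mathcal Q_\alpha$ be the set of those $Q\in\mathcal Q$ that consist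 of elements of $\mathcal T_\alpha$ and are maximal with this property with respect to inclusion. Let $L$ be the largest side length of a cube in $\mathcal Q_\alpha$ divided by $\varepsilon$, and let $\kappa$ be the maximum over $q\in\mathcal T_\alpha$ of the number of $Q\in\mathcal Q_\alpha$ that contain $q$; if $\mathcal T_\alpha=\emptyset$, put $L=\kappa=1$. *Preconditioner.* For a node $z$ of the periodic mesh (a point of $\varepsilon\mathbb Z^d$ modulo $\mathbb Z^d$) let $D_z$ be the cube of side length $2\varepsilon$ centred at $z$, and let $\mathcal V_z=H^1_0(D_z)\subset\mathcal V$ (functions extended by zero and periodically), i.e. the closure in $\mathcal V$ of the smooth periodic functions whose support is contained in $\operatorname{int} D_z+\mathbb Z^d$. The maps $\mathcal P_z:\mathcal V\to\mathcal V_z$ and $\tilde{\mathcal P}_z:\mathcal V^*\to\mathcal V_z$ are defined by $$a(\mathcal P_z u,v)=a(u,v),\qquad a(\tilde{\mathcal P}_z F,v)=\langle F,v\rangle\qquad\text{for all }v\in\mathcal V_z,$$ and $\mathcal P=\sum_z\mathcal P_z$, $\tilde{\mathcal P}=\sum_z\tilde{\mathcal P}_z$. **Theorem.** For every $d\ge1$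 and $c_0>0$ there is a constant $C>0$, depending only on $d$ and $c_0$, such that the following holds for all $n$ and all $\mathcal T_\alpha,\mathcal T_\beta$ as above. Put $$c_L=C\,\kappa\,L^d,\quad K_1=2^{d+1}\,(1+c_L^2L^2),\quad K_2=2^d,\quad \vartheta=\frac1{K_2+K_1^{-1}} .$$ Then $\kappa\le L^d$, and there is a number $\gamma_{\mathcal P}$ with $$0<\gamma_{\mathcal P}<1,\qquad \gamma_{\mathcal P}\le\frac{K_2}{K_1^{-1}+K_2},$$ not depending on $\alpha$ and $\beta$, such that for all $0\le\alpha\le\beta$ with $\beta\ge c_0\,\varepsilon^{-2}$ the continuous linear maps $\mathcal P_z$ and $\tilde{\mathcal P}_z$ exist and are unique, and $$|||\mathrm{id}-\vartheta\mathcal P|||=|||\mathrm{id}-\vartheta\tilde{\mathcal P}\mathcal A|||:=\sup_{v\in\mathcal V\setminus\{0\}}\frac{|||v-\vartheta\tilde{\mathcal P}\mathcal A v|||}{|||v|||}\le\gamma_{\mathcal P}<1 .$$ -/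

import Mathlib

open MeasureTheory
open scoped ENNReal ContDiff

noncomputable section

namespace Schroedinger

/-! ### Periodic Sobolev space and local spaces -/

/-- The unit cube `D = (0,1)^d`. -/
def unitCube (d : ℕ) : Set (Fin d → ℝ) := Set.pi Set.univ fun _ => Set.Ioo 0 1

/-- Lebesgue measure on `D`. -/
abbrev cubeMeasure (d : ℕ) : Measure (Fin d → ℝ) := volume.restrict (unitCube d)

/-- The real Hilbert space `L²(D)`. -/
abbrev L2 (d : ℕ) : Type := Lp ℝ 2 (cubeMeasure d)

/-- The Hilbert space `L²(D) × L²(D)^d` of pairs (function, candidate gradient), with norm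
`(‖u‖² + ∑ i, ‖g i‖²)^(1/2)`; on pairs `(u, ∇u)` this is the `H¹(D)` norm. -/
abbrev FunGrad (d : ℕ) : Type := WithLp 2 (L2 d × PiLp 2 fun _ : Fin d => L2 d)

/-- Smooth functions on `ℝ^d` that are periodic with respect to `ℤ^d`. -/
def IsSmoothPeriodic {d : ℕ} (φ : (Fin d → ℝ) → ℝ) : Prop :=
  ContDiff ℝ ∞ φ ∧ ∀ (x : Fin d → ℝ) (k : Fin d → ℤ), φ (fun i => x i + (k i : ℝ)) = φ x

/-- The partial derivative `∂φ/∂xᵢ`. -/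
def partialDeriv {d : ℕ} (i : Fin d) (φ : (Fin d → ℝ) → ℝ) (x : Fin d → ℝ) : ℝ :=
  fderiv ℝ φ x (Pi.single i 1)

/-- `p = (φ|_D, ∇φ|_D)` as classes of square integrable functions on `D`. -/
def IsGradPair {d : ℕ} (p : FunGrad d) (φ : (Fin d → ℝ) → ℝ) : Prop :=
  (p.fst : (Fin d → ℝ) → ℝ) =ᵐ[cubeMeasure d] φ ∧
    ∀ i, (p.snd i : (Fin d → ℝ) → ℝ) =ᵐ[cubeMeasure d] partialDeriv i φ

/-- The pairs `(φ, ∇φ)` with `φ` smooth, periodic, and supported (up to periodicity) in the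
periodic open set `U`. -/
def smoothPairs {d : ℕ} (U : Set (Fin d → ℝ)) : Submodule ℝ (FunGrad d) where
  carrier := {p | ∃ φ, IsSmoothPeriodic φ ∧ tsupport φ ⊆ U ∧ IsGradPair p φ}
  zero_mem' := by
    refine ⟨fun _ => 0, ⟨contDiff_const, fun _ _ => rfl⟩, ?_, ?_, fun i => ?_⟩
    · simp [tsupport]
    · exact Lp.coeFn_zero ℝ 2 (cubeMeasure d)
    · refine (Lp.coeFn_zero ℝ 2 (cubeMeasure d)).trans (Filter.Eventually.of_forall fun x => ?_)
      simp [partialDeriv]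
  add_mem' := by
    rintro p q ⟨φ, ⟨hφ, hφp⟩, hφU, h0, h1⟩ ⟨ψ, ⟨hψ, hψp⟩, hψU, k0, k1⟩
    refine ⟨fun x => φ x + ψ x, ⟨hφ.add hψ, fun x k => by simp only [hφp, hψp]⟩, ?_, ?_,
      fun i => ?_⟩
    · exact (tsupport_add φ ψ).trans (Set.union_subset hφU hψU)
    · filter_upwards [Lp.coeFn_add p.fst q.fst, h0, k0] with x hx h k
      rw [WithLp.add_fst, hx, Pi.add_apply, h, k]
    · filter_upwards [Lp.coeFn_add (p.snd i) (q.snd i), h1 i, k1 i] with x hx h k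
      rw [WithLp.add_snd, PiLp.add_apply, hx, Pi.add_apply, h, k, partialDeriv, partialDeriv,
        partialDeriv, fderiv_fun_add (hφ.differentiable (by simp) x)
        (hψ.differentiable (by simp) x), add_apply]
  smul_mem' := by
    rintro c p ⟨φ, ⟨hφ, hφp⟩, hφU, h0, h1⟩
    refine ⟨fun x => c * φ x, ⟨contDiff_const.mul hφ, fun x k => by simp only [hφp]⟩, ?_, ?_,
      fun i => ?_⟩
    · exact (tsupport_mul_subset_right (f := fun _ => c)).trans hφU
    · filter_upwards [Lp.coeFn_smul c p.fst, h0] with x hx h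
      rw [WithLp.smul_fst, hx, Pi.smul_apply, h, smul_eq_mul]
    · filter_upwards [Lp.coeFn_smul c (p.snd i), h1 i] with x hx h
      rw [WithLp.smul_snd, PiLp.smul_apply, hx, Pi.smul_apply, h, partialDeriv, partialDeriv,
        fderiv_const_mul (hφ.differentiable (by simp) x)]
      simp

/-- The space `H¹_per(D)`: the closure of the smooth periodic functions in the `H¹(D)` norm. An
element is stored together with its weak gradient, as the pair `(u, ∇u)`. -/
def Hper (d : ℕ) : Submodule ℝ (FunGrad d) := (smoothPairs Set.univ).topologicalClosure

/-- The function `u` underlying an element of `H¹_per(D)`. -/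
def fn {d : ℕ} (u : Hper d) : L2 d := (u : FunGrad d).fst

/-- The `i`-th component `∂ᵢu` of the weak gradient of an element of `H¹_per(D)`. -/
def pd {d : ℕ} (i : Fin d) (u : Hper d) : L2 d := (u : FunGrad d).snd i

/-! ### The mesh, the potential, and its geometry -/

/-- Elements of the mesh of width `ε = 1/n`, up to integer translations: the index `q` stands for
the cube `∏ᵢ [qᵢ/n, (qᵢ+1)/n]` modulo `ℤ^d`. Similarly, nodes `z/n` of the periodic mesh. -/
abbrev MeshIndex (d n : ℕ) : Type := Fin d → ZMod n

/-- The mesh element that contains the point `x ∈ ℝ^d`. -/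
def cellOf {d : ℕ} (n : ℕ) (x : Fin d → ℝ) : MeshIndex d n :=
  fun i => ((⌊(n : ℝ) * x i⌋ : ℤ) : ZMod n)

open Classical in
/-- The potential, equal to `β` on the elements in `B` and to `α` on all other elements. -/
def potential {d n : ℕ} (B : Set (MeshIndex d n)) (α β : ℝ) (x : Fin d → ℝ) : ℝ :=
  if cellOf n x ∈ B then β else α

/-- The cube with lower corner `c` consisting of `k^d` mesh elements (modulo `ℤ^d`). -/
def meshCube {d n : ℕ} (c : MeshIndex d n) (k : ℕ) : Set (MeshIndex d n) :=
  {q | ∀ i, ∃ j : ℕ, j < k ∧ q i = c i + (j : ZMod n)}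

/-- The set `𝒬` of all cubes that are unions of mesh elements, of side length `k/n`, `1 ≤ k ≤ n`. -/
def meshCubes (d n : ℕ) : Set (Set (MeshIndex d n)) :=
  {Q | ∃ (c : MeshIndex d n) (k : ℕ), 1 ≤ k ∧ k ≤ n ∧ Q = meshCube c k}

/-- The maximal cubes in the region where the potential equals `α`. -/
def maximalValleys {d n : ℕ} (B : Set (MeshIndex d n)) : Set (Set (MeshIndex d n)) :=
  {Q | Q ∈ meshCubes d n ∧ Q ⊆ Bᶜ ∧ ¬ ∃ Q' ∈ meshCubes d n, Q ⊂ Q' ∧ Q' ⊆ Bᶜ}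

/-- The maximal width `L` of a potential valley, in units of `ε`; it is `1` if there is none. -/
def valleyWidth {d n : ℕ} (B : Set (MeshIndex d n)) : ℕ :=
  max 1 (sSup {k | 1 ≤ k ∧ k ≤ n ∧ ∃ c : MeshIndex d n, meshCube c k ∈ maximalValleys B})

/-- The maximal number `κ` of maximal cubes of the `α`-region over one element of that region;
it is `1` if the `α`-region is empty. -/
def valleyOverlap {d n : ℕ} (B : Set (MeshIndex d n)) : ℕ :=
  max 1 (sSup {m | ∃ q ∈ Bᶜ, m = {Q | Q ∈ maximalValleys B ∧ q ∈ Q}.ncard})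

/-! ### The energy -/

lemma measurable_potential {d n : ℕ} (B : Set (MeshIndex d n)) (α β : ℝ) :
    Measurable (potential B α β) := by
  classical
  refine Measurable.ite ?_ measurable_const measurable_const
  have h : Measurable fun (x : Fin d → ℝ) (i : Fin d) => ⌊(n : ℝ) * x i⌋ :=
    measurable_pi_lambda _ fun i =>
      Measurable.floor (measurable_const.mul (measurable_pi_apply i))
  exact h (MeasurableSet.of_discrete (s := {f : Fin d → ℤ | (fun i => (f i : ZMod n)) ∈ B}))

lemma abs_potential_le {d n : ℕ} (B : Set (MeshIndex d n)) (α β : ℝ) (x : Fin d → ℝ) :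
    |potential B α β x| ≤ |α| + |β| := by
  unfold potential
  split_ifs
  · linarith [abs_nonneg α]
  · linarith [abs_nonneg β]

lemma integrable_mul_L2 {d : ℕ} (f g : L2 d) : Integrable (fun x => f x * g x) (cubeMeasure d) :=
  (Lp.memLp f).integrable_mul (Lp.memLp g)

lemma integrable_potential_mul {d n : ℕ} (B : Set (MeshIndex d n)) (α β : ℝ) (f g : L2 d) :
    Integrable (fun x => potential B α β x * (f x * g x)) (cubeMeasure d) :=
  (integrable_mul_L2 f g).bdd_mul (measurable_potential B α β).aestronglyMeasurable
    (Filter.Eventually.of_forall fun x => abs_potential_le B α β x)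

lemma integral_abs_mul_le {d : ℕ} (f g : L2 d) :
    ∫ x, |f x * g x| ∂cubeMeasure d ≤ ‖f‖ * ‖g‖ := by
  have h := real_inner_le_norm |f| |g|
  rw [norm_abs_eq_norm, norm_abs_eq_norm, L2.inner_def] at h
  refine (integral_congr_ae ?_).trans_le h
  filter_upwards [Lp.coeFn_abs f, Lp.coeFn_abs g] with x hf hg
  rw [hf, hg, abs_mul]
  simp [mul_comm]

/-- The integrand `∇u · ∇v + V u v` of the energy form. -/
def energyDensity {d n : ℕ} (B : Set (MeshIndex d n)) (α β : ℝ) (u v : Hper d)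
    (x : Fin d → ℝ) : ℝ :=
  (∑ i, pd i u x * pd i v x) + potential B α β x * (fn u x * fn v x)

lemma integrable_energyDensity {d n : ℕ} (B : Set (MeshIndex d n)) (α β : ℝ) (u v : Hper d) :
    Integrable (energyDensity B α β u v) (cubeMeasure d) := by
  unfold energyDensity
  exact (integrable_finsetSum _ fun i _ => integrable_mul_L2 (pd i u) (pd i v)).add
    (integrable_potential_mul B α β (fn u) (fn v))

lemma energyDensity_comm {d n : ℕ} (B : Set (MeshIndex d n)) (α β : ℝ) (u v : Hper d) :
    energyDensity B α β u v = energyDensity B α β v u := by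
  funext x
  simp only [energyDensity, mul_comm (fn u x), mul_comm (pd _ u x)]

lemma integral_energyDensity_add {d n : ℕ} (B : Set (MeshIndex d n)) (α β : ℝ) (u u' v : Hper d) :
    ∫ x in unitCube d, energyDensity B α β (u + u') v x =
      (∫ x in unitCube d, energyDensity B α β u v x) +
        ∫ x in unitCube d, energyDensity B α β u' v x := by
  rw [← integral_add (integrable_energyDensity B α β u v) (integrable_energyDensity B α β u' v)]
  refine integral_congr_ae ?_
  have h1 : ∀ᵐ x ∂cubeMeasure d, ∀ i, pd i (u + u') x = pd i u x + pd i u' x :=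
    ae_all_iff.2 fun i => Lp.coeFn_add (pd i u) (pd i u')
  filter_upwards [h1, Lp.coeFn_add (fn u) (fn u')] with x h1 h0
  have h0' : fn (u + u') x = fn u x + fn u' x := h0
  simp only [energyDensity, h1, h0', add_mul, mul_add, Finset.sum_add_distrib]
  ring

lemma integral_energyDensity_smul {d n : ℕ} (B : Set (MeshIndex d n)) (α β c : ℝ) (u v : Hper d) :
    ∫ x in unitCube d, energyDensity B α β (c • u) v x =
      c • ∫ x in unitCube d, energyDensity B α β u v x := by
  rw [← integral_smul]
  refine integral_congr_ae ?_
  have h1 : ∀ᵐ x ∂cubeMeasure d, ∀ i, pd i (c • u) x = c * pd i u x :=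
    ae_all_iff.2 fun i => Lp.coeFn_smul c (pd i u)
  filter_upwards [h1, Lp.coeFn_smul c (fn u)] with x h1 h0
  have h0' : fn (c • u) x = c * fn u x := h0
  simp only [energyDensity, h1, h0', smul_eq_mul, mul_add, Finset.mul_sum]
  congr 1
  · exact Finset.sum_congr rfl fun i _ => by ring
  · ring

lemma abs_integral_energyDensity_le {d n : ℕ} (B : Set (MeshIndex d n)) (α β : ℝ)
    (u v : Hper d) :
    ‖∫ x in unitCube d, energyDensity B α β u v x‖ ≤ (d + (|α| + |β|)) * ‖u‖ * ‖v‖ := by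
  have hp : ∀ (w : Hper d) (i : Fin d), ‖pd i w‖ ≤ ‖w‖ := fun w i =>
    (PiLp.norm_apply_le (w : FunGrad d).snd i).trans (WithLp.norm_snd_le (p := 2) (L2 d) (w : FunGrad d))
  have hf : ∀ w : Hper d, ‖fn w‖ ≤ ‖w‖ := fun w => WithLp.norm_fst_le (p := 2) (L2 d) (w : FunGrad d)
  have hI : ∀ i : Fin d, Integrable (fun x => |pd i u x * pd i v x|) (cubeMeasure d) :=
    fun i => (integrable_mul_L2 (pd i u) (pd i v)).abs
  have hJ : Integrable (fun x => (|α| + |β|) * |fn u x * fn v x|) (cubeMeasure d) :=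
    (integrable_mul_L2 (fn u) (fn v)).abs.const_mul _
  calc ‖∫ x in unitCube d, energyDensity B α β u v x‖
      ≤ ∫ x in unitCube d, (∑ i, |pd i u x * pd i v x| + (|α| + |β|) * |fn u x * fn v x|) := by
        refine norm_integral_le_of_norm_le
          ((integrable_finsetSum _ fun i _ => hI i).add hJ)
          (Filter.Eventually.of_forall fun x => ?_)
        refine (abs_add_le _ _).trans (add_le_add (Finset.abs_sum_le_sum_abs _ _) ?_)
        rw [abs_mul]
        exact mul_le_mul_of_nonneg_right (abs_potential_le B α β x) (abs_nonneg _)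
    _ = (∑ i, ∫ x in unitCube d, |pd i u x * pd i v x|) +
          (|α| + |β|) * ∫ x in unitCube d, |fn u x * fn v x| := by
        rw [integral_add (integrable_finsetSum _ fun i _ => hI i) hJ,
          integral_finsetSum _ fun i _ => hI i, integral_const_mul]
    _ ≤ ∑ _i : Fin d, ‖u‖ * ‖v‖ + (|α| + |β|) * (‖u‖ * ‖v‖) := by
        gcongr with i
        · exact (integral_abs_mul_le _ _).trans
            (mul_le_mul (hp u i) (hp v i) (norm_nonneg _) (norm_nonneg _))
        · exact (integral_abs_mul_le _ _).trans
            (mul_le_mul (hf u) (hf v) (norm_nonneg _) (norm_nonneg _))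
    _ = (d + (|α| + |β|)) * ‖u‖ * ‖v‖ := by
        simp
        ring

/-- The energy form `a(u, v) = ∫_D ∇u · ∇v + V u v` as a continuous bilinear form on `H¹_per(D)`.
Read as a map from `H¹_per(D)` to its dual, it is the operator `𝒜`. -/
def energyForm {d n : ℕ} (B : Set (MeshIndex d n)) (α β : ℝ) :
    Hper d →L[ℝ] StrongDual ℝ (Hper d) :=
  LinearMap.mkContinuous₂
    (LinearMap.mk₂ ℝ (fun u v : Hper d => ∫ x in unitCube d, energyDensity B α β u v x)
      (integral_energyDensity_add B α β)
      (fun c u v => integral_energyDensity_smul B α β c u v)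
      (fun u v v' => by
        simp only [energyDensity_comm B α β u]
        exact integral_energyDensity_add B α β v v' u)
      (fun c u v => by
        simp only [energyDensity_comm B α β u]
        exact integral_energyDensity_smul B α β c v u))
    (d + (|α| + |β|)) (abs_integral_energyDensity_le B α β)

lemma energyForm_apply {d n : ℕ} (B : Set (MeshIndex d n)) (α β : ℝ) (u v : Hper d) :
    energyForm B α β u v =
      ∫ x in unitCube d, ((∑ i, pd i u x * pd i v x) + potential B α β x * (fn u x * fn v x)) :=
  rfl

/-- The energy norm `|||v||| = a(v, v)^(1/2)`. -/
def energyNorm {d n : ℕ} (B : Set (MeshIndex d n)) (α β : ℝ) (v : Hper d) : ℝ :=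
  √(energyForm B α β v v)

/-- The operator norm `sup_v |||T v||| / |||v|||`, as an element of `[0, ∞]`. The conventions of
`ℝ≥0∞` are `0 / 0 = 0` and `x / 0 = ∞` for `x > 0`. -/
def energyOpNorm {d n : ℕ} (B : Set (MeshIndex d n)) (α β : ℝ) (T : Hper d →L[ℝ] Hper d) : ℝ≥0∞ :=
  ⨆ v : Hper d, ENNReal.ofReal (energyNorm B α β (T v)) / ENNReal.ofReal (energyNorm B α β v)

/-! ### Patches, local projections and constants -/

/-- The interior of the patch `D_z`, the cube of side length `2/n` centred at the node `z/n`,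
together with all its translates by `ℤ^d`. -/
def patch {d n : ℕ} (z : MeshIndex d n) : Set (Fin d → ℝ) :=
  {x | ∃ k : Fin d → ℤ, ∀ i, |x i - (((z i).val : ℝ) / n + k i)| < 1 / n}

/-- The space `V_z = H¹₀(D_z)`, continued by zero and periodically: the closure in `H¹_per(D)` of
the smooth periodic functions whose support lies in the patch. -/
def localSpace {d n : ℕ} (z : MeshIndex d n) : Submodule ℝ (Hper d) :=
  (smoothPairs (patch z)).topologicalClosure.comap (Hper d).subtype

/-- `Pz` is the `a`-orthogonal projection `P_z` of `H¹_per(D)` onto `V_z`: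
`P_z u ∈ V_z` and `a(P_z u, v) = a(u, v)` for all `v ∈ V_z`. -/
def IsLocalProjection {d n : ℕ} (B : Set (MeshIndex d n)) (α β : ℝ) (z : MeshIndex d n)
    (Pz : Hper d →L[ℝ] Hper d) : Prop :=
  ∀ u, Pz u ∈ localSpace z ∧ ∀ v ∈ localSpace z, energyForm B α β (Pz u) v = energyForm B α β u v

/-- `Rz` is the local solution operator `P̃_z` on the dual of `H¹_per(D)`:
`P̃_z F ∈ V_z` and `a(P̃_z F, v) = F(v)` for all `v ∈ V_z`. -/
def IsLocalSolver {d n : ℕ} (B : Set (MeshIndex d n)) (α β : ℝ) (z : MeshIndex d n)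
    (Rz : StrongDual ℝ (Hper d) →L[ℝ] Hper d) : Prop :=
  ∀ F, Rz F ∈ localSpace z ∧ ∀ v ∈ localSpace z, energyForm B α β (Rz F) v = F v

/-- The constant `K₂ = 2^d`. -/
def K₂ (d : ℕ) : ℝ := 2 ^ d

/-- The constant `K₁ = 2^(d+1) (1 + c_L² L²)` with `c_L = C κ L^d`. -/
def K₁ {d n : ℕ} (C : ℝ) (B : Set (MeshIndex d n)) : ℝ :=
  2 ^ (d + 1) * (1 + (C * valleyOverlap B * (valleyWidth B : ℝ) ^ d) ^ 2 * (valleyWidth B : ℝ) ^ 2)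

/-- The scaling factor `ϑ = 1 / (K₂ + K₁⁻¹)`. -/
def scaling {d n : ℕ} (C : ℝ) (B : Set (MeshIndex d n)) : ℝ := 1 / (K₂ d + (K₁ C B)⁻¹)

end Schroedinger

end

noncomputable section

namespace Schroedinger

/-! ### Combinatorics of the mesh -/

section Mesh

variable {d n : ℕ}

/-! The operator `P = ∑ z, P z` is an additive Schwarz operator, symmetric for the energy form `a`.
Everything rests on the spectral bounds `K₁⁻¹ a(u,u) ≤ a(Pu,u) ≤ K₂ a(u,u)`. With `ϑ = 1/(K₂ +
K₁⁻¹)` they place the numerical range of `id - ϑP` between `0` and `K₂/(K₁⁻¹ + K₂)`. Since `id - ϑP`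
is symmetric, this also bounds its energy norm (`form_sub_scaled_le`), and `γ` is taken to be this
value.

The upper bound only uses that a point lies in at most `2^d` patches (`card_patch_le`,
`energyForm_sum_le`, `form_sum_projection_le`).

The lower bound needs a stable decomposition `u = ∑ w z` with `w z` in the local spaces
(`form_le_of_decomposition`). For smooth `u` one multiplies by a smooth periodic partition of unity
with gradients of size `n` (`exists_decomposition`); density does the rest. The product rule
produces an extra term of order `n²‖u‖²`, which has to be absorbed into the energy.

This is done by the Friedrichs inequality `n²‖u‖² ≲ L^(d+2) a(u,u)` (`friedrichs`). By maximality of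
the valleys, each mesh element has an element of `B` at most `L` steps away in every direction
(`exists_offset_mem`). So `u(x)` is compared with `u(x + h)` for some mesh vector `h` with entries
at most `L/n` for which `x + h` lies where `V = β ≥ c₀n²`. Translation increments are controlled by
the gradient, and periodicity makes all translated integrals over the unit cube equal. The same
inequality gives coercivity, hence existence and uniqueness of the local operators. The overlap `κ`
plays no role beyond `κ ≥ 1`: the required `K₁` is larger than what this argument produces. -/

lemma meshCube_mono (c : MeshIndex d n) {k l : ℕ} (h : k ≤ l) : meshCube c k ⊆ meshCube c l :=
  fun _ hq i => (hq i).imp fun _ hj => ⟨hj.1.trans_le h, hj.2⟩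

lemma meshCube_self [NeZero n] (c : MeshIndex d n) : meshCube c n = Set.univ := by
  refine Set.eq_univ_of_forall fun q i => ⟨(q i - c i).val, ZMod.val_lt _, ?_⟩
  rw [ZMod.natCast_zmod_val]
  ring

lemma mem_meshCube_one (q : MeshIndex d n) : q ∈ meshCube q 1 :=
  fun _ => ⟨0, one_pos, by simp⟩

/-- The new corner has offset `k` in every direction, and `k < n` rules out that this offset wraps
around to a smaller one. For `d = 0` all cubes coincide, hence the assumption on `d`. -/
lemma meshCube_ne_succ (hd : 1 ≤ d) (c : MeshIndex d n) {k : ℕ} (hk : k < n) :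
    meshCube c k ≠ meshCube c (k + 1) := by
  intro h
  have hmem : (fun i => c i + (k : ZMod n)) ∈ meshCube c (k + 1) := fun i => ⟨k, k.lt_succ_self, rfl⟩
  rw [← h] at hmem
  obtain ⟨j, hj, e⟩ := hmem ⟨0, hd⟩
  have e' := (ZMod.natCast_eq_natCast_iff' _ _ _).1 (add_left_cancel e)
  rw [Nat.mod_eq_of_lt hk, Nat.mod_eq_of_lt (hj.trans hk)] at e'
  omega

lemma le_valleyWidth {B : Set (MeshIndex d n)} {c : MeshIndex d n} {k : ℕ} (h1 : 1 ≤ k)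
    (hn : k ≤ n) (h : meshCube c k ∈ maximalValleys B) : k ≤ valleyWidth B :=
  (le_csSup (s := {k | 1 ≤ k ∧ k ≤ n ∧ ∃ c : MeshIndex d n, meshCube c k ∈ maximalValleys B})
    ⟨n, fun _ hk => hk.2.1⟩ ⟨h1, hn, c, h⟩).trans (le_max_right _ _)

lemma one_le_valleyWidth (B : Set (MeshIndex d n)) : 1 ≤ valleyWidth B := le_max_left _ _

lemma one_le_valleyOverlap (B : Set (MeshIndex d n)) : 1 ≤ valleyOverlap B := le_max_left _ _

/-- Every element of the `α`-region lies in a maximal valley. -/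
lemma exists_maximalValley [NeZero n] {B : Set (MeshIndex d n)} {q : MeshIndex d n} (hq : q ∉ B) :
    ∃ (c : MeshIndex d n) (k : ℕ), 1 ≤ k ∧ k ≤ n ∧ q ∈ meshCube c k ∧
      meshCube c k ∈ maximalValleys B := by
  have hfin : {Q | Q ∈ meshCubes d n ∧ Q ⊆ Bᶜ}.Finite := Set.toFinite _
  have h1 : meshCube q 1 ⊆ Bᶜ := by
    intro p hp
    have : p = q := by
      funext i
      obtain ⟨j, hj, e⟩ := hp i
      obtain rfl : j = 0 := by omega
      simpa using e
    rwa [this]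
  obtain ⟨Q, hle, hQ⟩ := hfin.exists_le_maximal
    (show meshCube q 1 ∈ {Q | Q ∈ meshCubes d n ∧ Q ⊆ Bᶜ} from
      ⟨⟨q, 1, le_rfl, NeZero.one_le, rfl⟩, h1⟩)
  obtain ⟨⟨⟨c, k, hk1, hkn, rfl⟩, hQB⟩, hmax⟩ := hQ
  refine ⟨c, k, hk1, hkn, hle (mem_meshCube_one q), ⟨c, k, hk1, hkn, rfl⟩, hQB, ?_⟩
  rintro ⟨Q', hQ', hlt, hB⟩
  exact hlt.not_subset (hmax ⟨hQ', hB⟩ hlt.subset)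

/-- The number of maximal valleys over a mesh element is at most `L^d`. -/
lemma valleyOverlap_le [NeZero n] (B : Set (MeshIndex d n)) :
    valleyOverlap B ≤ valleyWidth B ^ d := by
  refine max_le (Nat.one_le_pow _ _ (one_le_valleyWidth B)) (csSup_le' ?_)
  rintro _ ⟨q, -, rfl⟩
  have : NeZero (valleyWidth B) := ⟨Nat.one_le_iff_ne_zero.1 (one_le_valleyWidth B)⟩
  -- A valley over `q` is described by its side length and the offset of `q` from its lower corner,
  -- whose entries are less than `k ≤ L`. Two valleys with the same offset share a corner, so they
  -- are nested and equal by maximality. Thus the offset alone is injective.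
  have key : ∀ Q ∈ {Q | Q ∈ maximalValleys B ∧ q ∈ Q}, ∃ (k : ℕ) (j : Fin d → Fin (valleyWidth B)),
      1 ≤ k ∧ k ≤ n ∧ Q = meshCube (fun i => q i - ((j i : ℕ) : ZMod n)) k := by
    rintro Q ⟨hQ, hq⟩
    obtain ⟨c, k, hk1, hkn, rfl⟩ := hQ.1
    choose j hj e using hq
    refine ⟨k, fun i => ⟨j i, (hj i).trans_le (le_valleyWidth hk1 hkn hQ)⟩, hk1, hkn, ?_⟩
    congr 1
    funext i
    simp [e i]
  choose! k j _ hkn hQ using key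
  calc {Q | Q ∈ maximalValleys B ∧ q ∈ Q}.ncard
      ≤ (Set.univ : Set (Fin d → Fin (valleyWidth B))).ncard := by
        refine Set.ncard_le_ncard_of_injOn j (fun _ _ => Set.mem_univ _) ?_ Set.finite_univ
        intro Q hQm Q' hQm' hj
        have e := hQ Q hQm
        have e' := hQ Q' hQm'
        rw [← hj] at e'
        rcases le_total (k Q) (k Q') with h | h
        · have hs : Q ⊆ Q' := by rw [e, e']; exact meshCube_mono _ h
          exact hs.eq_or_ssubset.resolve_right fun hlt => hQm.1.2.2 ⟨Q', hQm'.1.1, hlt, hQm'.1.2.1⟩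
        · have hs : Q' ⊆ Q := by rw [e, e']; exact meshCube_mono _ h
          exact (hs.eq_or_ssubset.resolve_right fun hlt =>
            hQm'.1.2.2 ⟨Q, hQm.1.1, hlt, hQm.1.2.1⟩).symm
    _ = valleyWidth B ^ d := by simp [Set.ncard_univ]

/-- From every mesh element, some element of `B` is at most `L` steps away in each direction. -/
lemma exists_offset_mem [NeZero n] (hd : 1 ≤ d) {B : Set (MeshIndex d n)} (hB : B.Nonempty)
    (q : MeshIndex d n) :
    ∃ m : Fin d → ℤ, (∀ i, -(valleyWidth B : ℤ) ≤ m i ∧ m i ≤ valleyWidth B) ∧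
      (fun i => q i + (m i : ZMod n)) ∈ B := by
  by_cases hq : q ∈ B
  · exact ⟨0, fun i => by simp, by simpa using hq⟩
  obtain ⟨c, k, hk1, hkn, hqk, hmax⟩ := exists_maximalValley hq
  have hL := le_valleyWidth hk1 hkn hmax
  -- Adding one layer to a maximal valley must hit `B`; if `k = n` the valley would be the whole
  -- mesh, contradicting that `B` is nonempty.
  have hb : ∃ b ∈ meshCube c (k + 1), b ∈ B := by
    by_contra! hcon
    rcases hkn.eq_or_lt with rfl | hlt
    · obtain ⟨b, hb⟩ := hB
      exact hcon b (meshCube_mono c k.le_succ (by rw [meshCube_self]; trivial : b ∈ meshCube c k)) hb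
    · refine hmax.2.2 ⟨meshCube c (k + 1), ⟨c, k + 1, by omega, hlt, rfl⟩, ?_, hcon⟩
      exact (meshCube_mono c k.le_succ).ssubset_of_ne (meshCube_ne_succ hd c hlt)
  obtain ⟨b, hb, hbB⟩ := hb
  choose j hj e using hqk
  choose j' hj' e' using hb
  -- Here `j ≤ k - 1` and `j' ≤ k`, so the difference lies in `[-L, L]` despite the extra layer.
  refine ⟨fun i => (j' i : ℤ) - j i, fun i => ?_, ?_⟩
  · have := hj i
    have := hj' i
    dsimp only
    omega
  · convert hbB using 1
    funext i
    rw [e, e']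
    push_cast
    ring

/-- A point lies in at most `2^d` patches. -/
lemma card_patch_le [NeZero n] (s : Finset (MeshIndex d n)) (x : Fin d → ℝ)
    (hs : ∀ z ∈ s, x ∈ patch z) : s.card ≤ 2 ^ d := by
  classical
  -- In each coordinate the node has an integer lift at distance less than `1` from `n * x i`, which
  -- leaves only the floor and its successor.
  have hsub : s ⊆ Fintype.piFinset fun i : Fin d =>
      ({((⌊(n : ℝ) * x i⌋ : ℤ) : ZMod n), ((⌊(n : ℝ) * x i⌋ + 1 : ℤ) : ZMod n)} : Finset (ZMod n)) := by
    intro z hz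
    obtain ⟨k, hk⟩ := hs z hz
    rw [Fintype.mem_piFinset]
    intro i
    have hn : (0 : ℝ) < n := Nat.cast_pos.2 (NeZero.pos n)
    have h := hk i
    have hz' : (((z i).val + n * k i : ℤ) : ZMod n) = z i := by simp
    have h' : |(n : ℝ) * x i - (((z i).val + n * k i : ℤ) : ℝ)| < 1 := by
      have : (n : ℝ) * x i - (((z i).val + n * k i : ℤ) : ℝ)
          = n * (x i - (((z i).val : ℝ) / n + k i)) := by
        push_cast
        field_simp
      rw [this, abs_mul, abs_of_pos hn]
      calc (n : ℝ) * _ < n * (1 / n) := by gcongr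
        _ = 1 := by field_simp
    generalize ((z i).val + n * k i : ℤ) = m at hz' h'
    rw [abs_lt] at h'
    have h1 := Int.floor_le ((n : ℝ) * x i)
    have h2 := Int.lt_floor_add_one ((n : ℝ) * x i)
    have h3 : ⌊(n : ℝ) * x i⌋ < m + 1 := by
      have : (⌊(n : ℝ) * x i⌋ : ℝ) < (m + 1 : ℤ) := by push_cast; linarith
      exact_mod_cast this
    have h4 : m < ⌊(n : ℝ) * x i⌋ + 2 := by
      have : (m : ℝ) < (⌊(n : ℝ) * x i⌋ + 2 : ℤ) := by push_cast; linarith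
      exact_mod_cast this
    rw [← hz', Finset.mem_insert, Finset.mem_singleton]
    rcases (show m = ⌊(n : ℝ) * x i⌋ ∨ m = ⌊(n : ℝ) * x i⌋ + 1 by omega) with h | h
    · left; rw [h]
    · right; rw [h]
  refine (Finset.card_le_card hsub).trans ?_
  rw [Fintype.card_piFinset]
  calc _ ≤ ∏ _i : Fin d, 2 := Finset.prod_le_prod' fun i _ => Finset.card_le_two
    _ = 2 ^ d := by simp

end Mesh

/-! ### A smooth periodic partition of unity -/

section Partition

open Filter Topology

/-- A smooth step that is `0` on `(-∞, 1/4]` and `1` on `[3/4, ∞)`. -/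
def smoothStep (t : ℝ) : ℝ := Real.smoothTransition (2 * t - 1 / 2)

lemma smoothStep_nonneg (t : ℝ) : 0 ≤ smoothStep t := Real.smoothTransition.nonneg _

lemma smoothStep_le_one (t : ℝ) : smoothStep t ≤ 1 := Real.smoothTransition.le_one _

lemma smoothStep_eq_zero {t : ℝ} (h : t ≤ 1 / 4) : smoothStep t = 0 :=
  Real.smoothTransition.zero_of_nonpos (by linarith)

lemma smoothStep_eq_one {t : ℝ} (h : 3 / 4 ≤ t) : smoothStep t = 1 :=
  Real.smoothTransition.one_of_one_le (by linarith)

lemma contDiff_smoothStep : ContDiff ℝ ∞ smoothStep :=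
  Real.smoothTransition.contDiff.comp ((contDiff_const.mul contDiff_id).sub contDiff_const)

lemma exists_abs_deriv_smoothStep_le :
    ∃ M : ℝ, 0 ≤ M ∧ ∀ t ∈ Set.Icc (0 : ℝ) 1, |deriv smoothStep t| ≤ M := by
  obtain ⟨M, hM⟩ := (isCompact_Icc (a := (0 : ℝ)) (b := 1)).exists_bound_of_continuousOn
    (contDiff_smoothStep.continuous_deriv (by simp)).continuousOn
  exact ⟨M, (norm_nonneg _).trans (hM 0 (by simp)), hM⟩

open Classical in
/-- The smooth hat function on `ℝ / nℤ` at the node `z`. -/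
def hat {n : ℕ} (z : ZMod n) (t : ℝ) : ℝ :=
  (if ((⌊t⌋ : ℤ) : ZMod n) = z then 1 - smoothStep (Int.fract t) else 0) +
    (if ((⌊t⌋ + 1 : ℤ) : ZMod n) = z then smoothStep (Int.fract t) else 0)

variable {n : ℕ}

lemma hat_nonneg (z : ZMod n) (t : ℝ) : 0 ≤ hat z t := by
  have h0 := smoothStep_nonneg (Int.fract t)
  have h1 := smoothStep_le_one (Int.fract t)
  unfold hat
  split_ifs <;> linarith

lemma hat_le_one (z : ZMod n) (t : ℝ) : hat z t ≤ 1 := by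
  have h0 := smoothStep_nonneg (Int.fract t)
  have h1 := smoothStep_le_one (Int.fract t)
  unfold hat
  split_ifs <;> linarith

lemma sum_hat [NeZero n] (t : ℝ) : ∑ z : ZMod n, hat z t = 1 := by
  classical
  simp [hat, Finset.sum_add_distrib]

lemma hat_add (z : ZMod n) (t : ℝ) (k : ℤ) : hat z (t + n * k) = hat z t := by
  have h : t + n * k = t + ((n * k : ℤ) : ℝ) := by push_cast; rfl
  rw [h]
  unfold hat
  rw [Int.floor_add_intCast, Int.fract_add_intCast]
  simp

-- `smoothStep` is constant up to `1/4` and from `3/4` on, so the branches of `hat` on both sides of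
-- an integer are constant and agree within distance `1/4`. This makes `hat` smooth there although
-- it is built from `Int.floor` and `Int.fract`.
open Classical in
lemma hat_eventuallyEq_of_int (z : ZMod n) (m : ℤ) :
    hat z =ᶠ[𝓝 (m : ℝ)] fun _ => if (m : ZMod n) = z then 1 else 0 := by
  filter_upwards [Ioo_mem_nhds (show (m : ℝ) - 1 / 4 < m by linarith)
    (show (m : ℝ) < m + 1 / 4 by linarith)] with t ht
  rcases lt_or_ge t m with h | h
  · have hf : ⌊t⌋ = m - 1 := by
      rw [Int.floor_eq_iff]
      push_cast
      constructor <;> linarith [ht.1]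
    have hs : smoothStep (Int.fract t) = 1 := by
      apply smoothStep_eq_one
      rw [Int.fract, hf]
      push_cast
      linarith [ht.1]
    simp [hat, hf, hs]
  · have hf : ⌊t⌋ = m := by
      rw [Int.floor_eq_iff]
      constructor <;> linarith [ht.2]
    have hs : smoothStep (Int.fract t) = 0 := by
      apply smoothStep_eq_zero
      rw [Int.fract, hf]
      linarith [ht.2]
    simp [hat, hf, hs]

open Classical in
lemma hat_eventuallyEq_of_floor_lt (z : ZMod n) {t : ℝ} (ht : (⌊t⌋ : ℝ) < t) :
    hat z =ᶠ[𝓝 t] fun s =>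
      (if ((⌊t⌋ : ℤ) : ZMod n) = z then 1 - smoothStep (s - ⌊t⌋) else 0) +
        (if ((⌊t⌋ + 1 : ℤ) : ZMod n) = z then smoothStep (s - ⌊t⌋) else 0) := by
  filter_upwards [Ioo_mem_nhds ht (Int.lt_floor_add_one t)] with s hs
  have hf : ⌊s⌋ = ⌊t⌋ := by
    rw [Int.floor_eq_iff]
    exact ⟨hs.1.le, hs.2⟩
  simp [hat, hf, Int.fract]

lemma contDiff_smoothStep_sub (c : ℝ) : ContDiff ℝ ∞ fun s => smoothStep (s - c) :=
  contDiff_smoothStep.comp (contDiff_id.sub contDiff_const)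

lemma contDiff_hat (z : ZMod n) : ContDiff ℝ ∞ (hat z) := by
  classical
  rw [contDiff_iff_contDiffAt]
  intro t
  rcases (Int.floor_le t).eq_or_lt with h | h
  · rw [← h]
    exact contDiffAt_const.congr_of_eventuallyEq (hat_eventuallyEq_of_int z _)
  · refine ContDiffAt.congr_of_eventuallyEq ?_ (hat_eventuallyEq_of_floor_lt z h)
    have hs := contDiff_smoothStep_sub ⌊t⌋
    refine ContDiff.contDiffAt (ContDiff.add ?_ ?_)
    · split_ifs
      exacts [contDiff_const.sub hs, contDiff_const]
    · split_ifs
      exacts [hs, contDiff_const]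

lemma abs_deriv_hat_le {M : ℝ} (hM0 : 0 ≤ M)
    (hM : ∀ t ∈ Set.Icc (0 : ℝ) 1, |deriv smoothStep t| ≤ M) (z : ZMod n) (t : ℝ) :
    |deriv (hat z) t| ≤ M := by
  classical
  rcases (Int.floor_le t).eq_or_lt with h | h
  · rw [← h, (hat_eventuallyEq_of_int z _).deriv_eq]
    simpa using hM0
  · rw [(hat_eventuallyEq_of_floor_lt z h).deriv_eq]
    have hd : DifferentiableAt ℝ (fun s => smoothStep (s - ⌊t⌋)) t :=
      (contDiff_smoothStep_sub _).differentiable (by simp) t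
    have hM' := hM (t - ⌊t⌋) ⟨by linarith, by linarith [Int.lt_floor_add_one t]⟩
    rw [← deriv_comp_sub_const] at hM'
    split_ifs
    · simpa using hM0
    · simpa [deriv_const_sub] using hM'
    · simpa using hM'
    · simpa using hM0

/-- The non-strict bound suffices: at distance exactly `1` the point is an integer, where `hat` is
locally constant. This flatness is what places the closed support of the bump inside the open patch.
-/
lemma hat_eventuallyEq_zero (z : ZMod n) {t : ℝ} (h : ∀ m : ℤ, (m : ZMod n) = z → 1 ≤ |t - m|) :
    hat z =ᶠ[𝓝 t] 0 := by
  classical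
  rcases (Int.floor_le t).eq_or_lt with h' | h'
  · have hz : ((⌊t⌋ : ℤ) : ZMod n) ≠ z := fun e => by
      have := h _ e
      rw [h', sub_self, abs_zero] at this
      linarith
    have := hat_eventuallyEq_of_int z ⌊t⌋
    rw [if_neg hz, h'] at this
    exact this
  · have h1 : ((⌊t⌋ : ℤ) : ZMod n) ≠ z := fun e => by
      have := h _ e
      rw [abs_of_pos (by linarith)] at this
      linarith [Int.lt_floor_add_one t]
    have h2 : ((⌊t⌋ + 1 : ℤ) : ZMod n) ≠ z := fun e => by
      have := h _ e
      have h3 := Int.lt_floor_add_one t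
      push_cast at this
      rw [abs_of_neg (by linarith)] at this
      linarith
    have := hat_eventuallyEq_of_floor_lt z h'
    simp only [if_neg h1, if_neg h2, add_zero] at this
    exact this

variable {d : ℕ}

/-- The partition of unity subordinate to the patches. -/
def nodeBump (z : MeshIndex d n) (x : Fin d → ℝ) : ℝ := ∏ i, hat (z i) (n * x i)

lemma nodeBump_nonneg (z : MeshIndex d n) (x : Fin d → ℝ) : 0 ≤ nodeBump z x :=
  Finset.prod_nonneg fun _ _ => hat_nonneg _ _

lemma nodeBump_le_one (z : MeshIndex d n) (x : Fin d → ℝ) : nodeBump z x ≤ 1 :=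
  Finset.prod_le_one (fun _ _ => hat_nonneg _ _) fun _ _ => hat_le_one _ _

lemma sum_nodeBump [NeZero n] (x : Fin d → ℝ) : ∑ z : MeshIndex d n, nodeBump z x = 1 := by
  classical
  have h := Finset.prod_univ_sum (fun _ : Fin d => (Finset.univ : Finset (ZMod n)))
    (fun i z => hat z (n * x i))
  simp only [sum_hat, Finset.prod_const_one, Fintype.piFinset_univ] at h
  exact h.symm

lemma contDiff_hat_coord (z : ZMod n) (i : Fin d) :
    ContDiff ℝ ∞ fun x : Fin d → ℝ => hat z (n * x i) :=
  (contDiff_hat z).comp (contDiff_const.mul (contDiff_apply ℝ ℝ i))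

lemma isSmoothPeriodic_nodeBump (z : MeshIndex d n) : IsSmoothPeriodic (nodeBump z) := by
  refine ⟨contDiff_prod fun i _ => contDiff_hat_coord (z i) i, fun x k => ?_⟩
  refine Finset.prod_congr rfl fun i _ => ?_
  rw [mul_add, hat_add]

lemma tsupport_nodeBump_subset [NeZero n] (z : MeshIndex d n) : tsupport (nodeBump z) ⊆ patch z := by
  intro x hx
  by_contra hxz
  refine notMem_tsupport_iff_eventuallyEq.2 ?_ hx
  have hn : (0 : ℝ) < n := Nat.cast_pos.2 (NeZero.pos n)
  -- If every coordinate were within distance `1` of some lift of `z i`, these lifts would differ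
  -- from `(z i).val` by multiples of `n`, which put `x` into the patch. So one factor of the
  -- product vanishes near `x`.
  have hi : ∃ i, ∀ m : ℤ, (m : ZMod n) = z i → 1 ≤ |n * x i - m| := by
    by_contra! hcon
    refine hxz ?_
    choose m hm hlt using hcon
    have hk : ∀ i, ∃ k : ℤ, m i = (z i).val + n * k := fun i => by
      have h : ((m i - (z i).val : ℤ) : ZMod n) = 0 := by simp [hm i]
      obtain ⟨k, hk⟩ := (ZMod.intCast_zmod_eq_zero_iff_dvd _ _).1 h
      exact ⟨k, by linarith⟩
    choose k hk using hk
    refine ⟨k, fun i => ?_⟩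
    have h := hlt i
    have e : (n : ℝ) * x i - m i = n * (x i - (((z i).val : ℝ) / n + k i)) := by
      rw [hk i]
      push_cast
      field_simp
    rw [e, abs_mul, abs_of_pos hn] at h
    rwa [lt_div_iff₀' hn]
  obtain ⟨i, hi⟩ := hi
  have hc : Tendsto (fun y : Fin d → ℝ => (n : ℝ) * y i) (𝓝 x) (𝓝 (n * x i)) :=
    (continuous_const.mul (continuous_apply i)).tendsto x
  filter_upwards [hc.eventually (hat_eventuallyEq_zero (z i) hi)] with y hy
  exact Finset.prod_eq_zero (Finset.mem_univ i) hy

/-- Only the `i`-th factor depends on `x i`; the scaling by `n` gives the factor `n`, and the other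
factors are at most `1`. -/
lemma abs_partialDeriv_nodeBump_le {M : ℝ} (hM0 : 0 ≤ M)
    (hM : ∀ t ∈ Set.Icc (0 : ℝ) 1, |deriv smoothStep t| ≤ M) (z : MeshIndex d n) (i : Fin d)
    (x : Fin d → ℝ) : |partialDeriv i (nodeBump z) x| ≤ n * M := by
  classical
  have hdiff : ∀ j : Fin d, HasFDerivAt (fun y : Fin d → ℝ => hat (z j) (n * y j))
      (deriv (hat (z j)) (n * x j) • ((n : ℝ) • ContinuousLinearMap.proj (R := ℝ) (φ := fun _ : Fin d => ℝ) j)) x := by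
    intro j
    have h1 : HasDerivAt (hat (z j)) (deriv (hat (z j)) (n * x j)) (n * x j) :=
      ((contDiff_hat (z j)).differentiable (by simp) _).hasDerivAt
    have h2 : HasFDerivAt (fun y : Fin d → ℝ => (n : ℝ) * y j)
        ((n : ℝ) • ContinuousLinearMap.proj (R := ℝ) (φ := fun _ : Fin d => ℝ) j) x :=
      (hasFDerivAt_apply j x).const_mul _
    exact h1.comp_hasFDerivAt x h2
  have h := (HasFDerivAt.finsetProd (u := Finset.univ) fun j _ => hdiff j).fderiv
  have h' : partialDeriv i (nodeBump z) x =
      (∏ j ∈ Finset.univ.erase i, hat (z j) (n * x j)) * (deriv (hat (z i)) (n * x i) * n) := by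
    unfold partialDeriv
    have : nodeBump z = fun y => ∏ j, hat (z j) (n * y j) := rfl
    rw [this, h]
    simp [Pi.single_apply]
  rw [h', abs_mul, abs_mul, abs_of_nonneg (Finset.prod_nonneg fun _ _ => hat_nonneg _ _),
    Nat.abs_cast]
  calc _ ≤ 1 * (M * n) := by
        gcongr
        · exact Finset.prod_le_one (fun _ _ => hat_nonneg _ _) fun _ _ => hat_le_one _ _
        · exact abs_deriv_hat_le hM0 hM _ _
    _ = n * M := by ring

end Partition

/-! ### Translations of periodic functions -/

section Translation

variable {d : ℕ}

/-- `ℤ^d`-periodicity. -/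
def IsPeriodic (f : (Fin d → ℝ) → ℝ) : Prop :=
  ∀ (x : Fin d → ℝ) (k : Fin d → ℤ), f (fun i => x i + (k i : ℝ)) = f x

/-- The half-open cube is a fundamental domain of `ℤ^d`; up to null sets it may replace the open
one. -/
lemma unitCube_ae_eq : unitCube d =ᵐ[volume] ZSpan.fundamentalDomain (Pi.basisFun ℝ (Fin d)) := by
  rw [ZSpan.fundamentalDomain_pi_basisFun]
  exact Measure.univ_pi_Ioo_ae_eq_Icc.trans Measure.univ_pi_Ico_ae_eq_Icc.symm

lemma unitCube_ae_eq_Icc : unitCube d =ᵐ[volume] Set.Icc (0 : Fin d → ℝ) 1 :=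
  Measure.univ_pi_Ioo_ae_eq_Icc (f := fun _ : Fin d => (0 : ℝ)) (g := fun _ => 1)

instance : IsFiniteMeasure (cubeMeasure d) := by
  refine ⟨?_⟩
  rw [Measure.restrict_apply_univ, measure_congr unitCube_ae_eq_Icc]
  exact isCompact_Icc.measure_lt_top

lemma integrable_of_continuous {f : (Fin d → ℝ) → ℝ} (hf : Continuous f) :
    Integrable f (cubeMeasure d) := by
  rw [cubeMeasure, Measure.restrict_congr_set unitCube_ae_eq_Icc]
  exact hf.continuousOn.integrableOn_compact isCompact_Icc

/-- A translate of a fundamental domain is again a fundamental domain, and a periodic function has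
the same integral over both. -/
lemma integral_unitCube_translate {f : (Fin d → ℝ) → ℝ} (hf : IsPeriodic f) (h : Fin d → ℝ) :
    ∫ x in unitCube d, f (x + h) = ∫ x in unitCube d, f x := by
  have hD := ZSpan.isAddFundamentalDomain (Pi.basisFun ℝ (Fin d)) volume
  have hD' := hD.vadd_of_comm h
  have hper : ∀ (g : Submodule.span ℤ (Set.range (Pi.basisFun ℝ (Fin d)))) (x : Fin d → ℝ),
      f (g +ᵥ x) = f x := by
    intro g x
    have hg := ((Pi.basisFun ℝ (Fin d)).mem_span_iff_repr_mem ℤ (g : Fin d → ℝ)).1 g.2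
    choose k hk using hg
    rw [← hf x k]
    congr 1
    funext i
    have := hk i
    simp only [Pi.basisFun_repr] at this
    rw [Submodule.vadd_def, vadd_eq_add, Pi.add_apply, ← this]
    simp [add_comm]
  have : VAddInvariantMeasure (Submodule.span ℤ (Set.range (Pi.basisFun ℝ (Fin d))))
      (Fin d → ℝ) volume := ⟨fun g s _ => measure_preimage_add volume (g : Fin d → ℝ) s⟩
  rw [setIntegral_congr_set unitCube_ae_eq, setIntegral_congr_set unitCube_ae_eq,
    ← hD'.setIntegral_eq hD hper]
  have := (measurePreserving_add_left volume h).setIntegral_image_emb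
    (measurableEmbedding_addLeft h) f (ZSpan.fundamentalDomain (Pi.basisFun ℝ (Fin d)))
  simp only [add_comm _ h]
  exact this.symm

/-- The variance of `g` about its mean `c` is nonnegative. -/
lemma sq_intervalIntegral_le {g : ℝ → ℝ} (hg : Continuous g) :
    (∫ s in (0 : ℝ)..1, g s) ^ 2 ≤ ∫ s in (0 : ℝ)..1, g s ^ 2 := by
  set c := ∫ s in (0 : ℝ)..1, g s with hc
  have h0 : 0 ≤ ∫ s in (0 : ℝ)..1, (g s - c) ^ 2 :=
    intervalIntegral.integral_nonneg zero_le_one fun _ _ => sq_nonneg _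
  have h1 : ∫ s in (0 : ℝ)..1, (g s - c) ^ 2 = (∫ s in (0 : ℝ)..1, g s ^ 2) - c ^ 2 := by
    have : ∀ s, (g s - c) ^ 2 = g s ^ 2 - (2 * c) * g s + c ^ 2 := fun s => by ring
    simp only [this]
    rw [intervalIntegral.integral_add, intervalIntegral.integral_sub,
      intervalIntegral.integral_const_mul, ← hc]
    · simp; ring
    all_goals exact Continuous.intervalIntegrable (by fun_prop) _ _
  linarith

/-- The increment of a smooth function under a translation is controlled by the gradient. -/
lemma sq_sub_le_intervalIntegral {φ : (Fin d → ℝ) → ℝ} (hφ : ContDiff ℝ ∞ φ) (x h : Fin d → ℝ) :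
    (φ (x + h) - φ x) ^ 2 ≤ ∫ s in (0 : ℝ)..1, (fderiv ℝ φ (x + s • h) h) ^ 2 := by
  have hc : Continuous fun s : ℝ => fderiv ℝ φ (x + s • h) h :=
    ((hφ.continuous_fderiv (by simp)).comp (by fun_prop)).clm_apply continuous_const
  have hd : ∀ s : ℝ, HasDerivAt (fun s : ℝ => φ (x + s • h)) (fderiv ℝ φ (x + s • h) h) s := by
    intro s
    have h1 := (hφ.differentiable (by simp) (x + s • h)).hasFDerivAt
    have h2 : HasDerivAt (fun s : ℝ => x + s • h) h s := by
      simpa using ((hasDerivAt_id s).smul_const h).const_add x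
    exact h1.comp_hasDerivAt s h2
  have := intervalIntegral.integral_eq_sub_of_hasDerivAt (fun s _ => hd s)
    (hc.intervalIntegrable 0 1)
  simp only [one_smul, zero_smul, add_zero] at this
  rw [← this]
  exact sq_intervalIntegral_le hc

lemma fderiv_apply_eq_sum (φ : (Fin d → ℝ) → ℝ) (x h : Fin d → ℝ) :
    fderiv ℝ φ x h = ∑ i, h i * partialDeriv i φ x := by
  conv_lhs => rw [pi_eq_sum_univ' h]
  simp [partialDeriv, map_sum]

lemma sq_fderiv_apply_le (φ : (Fin d → ℝ) → ℝ) (x h : Fin d → ℝ) :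
    (fderiv ℝ φ x h) ^ 2 ≤ (∑ i, h i ^ 2) * ∑ i, partialDeriv i φ x ^ 2 := by
  rw [fderiv_apply_eq_sum]
  exact Finset.sum_mul_sq_le_sq_mul_sq _ _ _

lemma IsSmoothPeriodic.partialDeriv_periodic {φ : (Fin d → ℝ) → ℝ} (hφ : IsSmoothPeriodic φ)
    (i : Fin d) : IsPeriodic (partialDeriv i φ) := by
  intro x k
  have h : (fun y : Fin d → ℝ => φ (y + fun i => (k i : ℝ))) = φ := funext fun y => hφ.2 y k
  have := fderiv_comp_add_right (𝕜 := ℝ) (f := φ) (x := x) (fun i => (k i : ℝ))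
  rw [h] at this
  unfold partialDeriv
  rw [this]
  rfl

lemma IsSmoothPeriodic.continuous_partialDeriv {φ : (Fin d → ℝ) → ℝ} (hφ : IsSmoothPeriodic φ)
    (i : Fin d) : Continuous (partialDeriv i φ) :=
  (hφ.1.continuous_fderiv (by simp)).clm_apply continuous_const

/-- `‖φ(· + h) - φ‖² ≤ |h|² ‖∇φ‖²` for smooth periodic functions. -/
lemma integral_sq_translate_sub_le {φ : (Fin d → ℝ) → ℝ} (hφ : IsSmoothPeriodic φ)
    (h : Fin d → ℝ) :
    ∫ x in unitCube d, (φ (x + h) - φ x) ^ 2 ≤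
      (∑ i, h i ^ 2) * ∫ x in unitCube d, ∑ i, partialDeriv i φ x ^ 2 := by
  have hcφ : Continuous φ := hφ.1.continuous
  have hcd := fun i => hφ.continuous_partialDeriv i
  have hG : IsPeriodic fun x => ∑ i, partialDeriv i φ x ^ 2 := fun x k => by
    simp only [hφ.partialDeriv_periodic _ x k]
  have hGc : Continuous fun x => ∑ i, partialDeriv i φ x ^ 2 := by fun_prop
  have hF : Continuous fun p : (Fin d → ℝ) × ℝ => ∑ i, partialDeriv i φ (p.1 + p.2 • h) ^ 2 :=
    hGc.comp (by fun_prop)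
  have hpt : ∀ x, (φ (x + h) - φ x) ^ 2 ≤
      (∑ i, h i ^ 2) * ∫ s in (0 : ℝ)..1, ∑ i, partialDeriv i φ (x + s • h) ^ 2 := by
    intro x
    refine (sq_sub_le_intervalIntegral hφ.1 x h).trans ?_
    rw [← intervalIntegral.integral_const_mul]
    refine intervalIntegral.integral_mono_on zero_le_one ?_ ?_ fun s _ => sq_fderiv_apply_le _ _ _
    · refine Continuous.intervalIntegrable ?_ _ _
      exact (((hφ.1.continuous_fderiv (by simp)).comp (by fun_prop)).clm_apply
        continuous_const).pow 2
    · exact Continuous.intervalIntegrable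
        (continuous_const.mul (hF.comp (by fun_prop : Continuous fun s : ℝ => (x, s)))) _ _
  -- Continuity on the compact product of closed cube and interval justifies Fubini. After the swap,
  -- translation invariance removes `s • h` for each fixed `s`.
  have hint : Integrable (fun p : (Fin d → ℝ) × ℝ => ∑ i, partialDeriv i φ (p.1 + p.2 • h) ^ 2)
      ((cubeMeasure d).prod (volume.restrict (Set.Ioc (0 : ℝ) 1))) := by
    rw [cubeMeasure, Measure.restrict_congr_set unitCube_ae_eq_Icc,
      Measure.restrict_congr_set Ioc_ae_eq_Icc, Measure.prod_restrict]
    exact hF.continuousOn.integrableOn_compact (isCompact_Icc.prod isCompact_Icc)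
  calc ∫ x in unitCube d, (φ (x + h) - φ x) ^ 2
      ≤ ∫ x in unitCube d, (∑ i, h i ^ 2) *
          ∫ s in (0 : ℝ)..1, ∑ i, partialDeriv i φ (x + s • h) ^ 2 := by
        refine integral_mono (integrable_of_continuous (by fun_prop)) ?_ hpt
        refine Integrable.const_mul ?_ _
        simp only [intervalIntegral.integral_of_le zero_le_one]
        exact hint.integral_prod_left
    _ = (∑ i, h i ^ 2) * ∫ s in (0 : ℝ)..1, ∫ x in unitCube d,
          ∑ i, partialDeriv i φ (x + s • h) ^ 2 := by
        rw [integral_const_mul]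
        simp only [intervalIntegral.integral_of_le zero_le_one]
        rw [integral_integral_swap hint]
    _ = (∑ i, h i ^ 2) * ∫ x in unitCube d, ∑ i, partialDeriv i φ x ^ 2 := by
        congr 1
        have : ∀ s : ℝ, ∫ x in unitCube d, ∑ i, partialDeriv i φ (x + s • h) ^ 2 =
            ∫ x in unitCube d, ∑ i, partialDeriv i φ x ^ 2 :=
          fun s => integral_unitCube_translate hG (s • h)
        simp [this]

end Translation

/-! ### A Friedrichs inequality for smooth periodic functions -/

section Friedrichs

variable {d n : ℕ}

lemma cellOf_translate [NeZero n] (x : Fin d → ℝ) (m : Fin d → ℤ) :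
    cellOf n (x + fun i => (m i : ℝ) / n) = fun i => cellOf n x i + (m i : ZMod n) := by
  funext i
  have hn : (n : ℝ) ≠ 0 := Nat.cast_ne_zero.2 (NeZero.ne n)
  have : (n : ℝ) * (x + fun i => (m i : ℝ) / n) i = n * x i + m i := by
    simp only [Pi.add_apply]
    field_simp
  rw [cellOf, this, Int.floor_add_intCast]
  simp [cellOf]

lemma isPeriodic_potential (B : Set (MeshIndex d n)) (α β : ℝ) :
    IsPeriodic (potential B α β) := by
  intro x k
  have : cellOf n (fun i => x i + (k i : ℝ)) = cellOf n x := by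
    funext i
    have h : (n : ℝ) * (x i + k i) = n * x i + ((n * k i : ℤ) : ℝ) := by push_cast; ring
    rw [cellOf, h, Int.floor_add_intCast]
    simp [cellOf]
  unfold potential
  rw [this]

lemma potential_nonneg (B : Set (MeshIndex d n)) {α β : ℝ} (hα : 0 ≤ α) (hαβ : α ≤ β)
    (x : Fin d → ℝ) : 0 ≤ potential B α β x := by
  unfold potential
  split_ifs <;> linarith

lemma integrable_potential_translate_mul (B : Set (MeshIndex d n)) (α β : ℝ) (h : Fin d → ℝ)
    {g : (Fin d → ℝ) → ℝ} (hg : Continuous g) :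
    Integrable (fun x => potential B α β (x + h) * g x) (cubeMeasure d) :=
  (integrable_of_continuous hg).bdd_mul
    ((measurable_potential B α β).comp (measurable_add_const h)).aestronglyMeasurable
    (Filter.Eventually.of_forall fun x => abs_potential_le B α β (x + h))

lemma integrable_potential_mul_continuous (B : Set (MeshIndex d n)) (α β : ℝ)
    {g : (Fin d → ℝ) → ℝ} (hg : Continuous g) :
    Integrable (fun x => potential B α β x * g x) (cubeMeasure d) := by
  simpa using integrable_potential_translate_mul B α β 0 hg

/-- The integer offsets with entries in `[-L, L]`. -/
def offsets (d L : ℕ) : Finset (Fin d → ℤ) := Fintype.piFinset fun _ => Finset.Icc (-(L : ℤ)) L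

lemma card_offsets (d L : ℕ) : (offsets d L).card = (2 * L + 1) ^ d := by
  simp only [offsets, Fintype.card_piFinset, Int.card_Icc, Finset.prod_const, Finset.card_univ,
    Fintype.card_fin]
  congr 1
  omega

/-- A smooth periodic function is controlled by its gradient and its values on `B`. -/
lemma integral_sq_le_of_smooth [NeZero n] (hd : 1 ≤ d) {B : Set (MeshIndex d n)} (hB : B.Nonempty)
    {φ : (Fin d → ℝ) → ℝ} (hφ : IsSmoothPeriodic φ) :
    (n : ℝ) ^ 2 * ∫ x in unitCube d, φ x ^ 2 ≤
      (2 * valleyWidth B + 1) ^ d *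
        (2 * n ^ 2 * (∫ x in unitCube d, potential B 0 1 x * φ x ^ 2) +
          2 * d * (valleyWidth B : ℝ) ^ 2 * ∫ x in unitCube d, ∑ i, partialDeriv i φ x ^ 2) := by
  have hn : (0 : ℝ) < n := Nat.cast_pos.2 (NeZero.pos n)
  have hc : Continuous φ := hφ.1.continuous
  set L := valleyWidth B with hL
  set shift : (Fin d → ℤ) → Fin d → ℝ := fun m i => (m i : ℝ) / n with hshift
  -- The suitable offset depends on the mesh element containing `x`. Summing over all offsets
  -- removes this dependence, at the price of the factor `(2L+1)^d`.
  have hpt : ∀ x, φ x ^ 2 ≤ ∑ m ∈ offsets d L,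
      (2 * (potential B 0 1 (x + shift m) * φ (x + shift m) ^ 2) +
        2 * (φ (x + shift m) - φ x) ^ 2) := by
    intro x
    obtain ⟨m, hm, hmB⟩ := exists_offset_mem hd hB (cellOf n x)
    have h1 : potential B 0 1 (x + shift m) = 1 := by
      rw [potential, if_pos]
      rwa [hshift, cellOf_translate]
    refine le_trans ?_ (Finset.single_le_sum (f := fun m =>
      2 * (potential B 0 1 (x + shift m) * φ (x + shift m) ^ 2) +
        2 * (φ (x + shift m) - φ x) ^ 2) (fun m _ => ?_) (show m ∈ offsets d L from ?_))
    · rw [h1]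
      -- With `b = φ (x + shift m)` and `a = φ x`, the gap is `2b² + 2(b - a)² - a² = (2b - a)²`.
      nlinarith [sq_nonneg (2 * φ (x + shift m) - φ x)]
    · have := potential_nonneg B le_rfl zero_le_one (x + shift m)
      positivity
    · simpa [offsets] using hm
  have hI1 : ∀ h : Fin d → ℝ, Integrable (fun x => 2 * (potential B 0 1 (x + h) * φ (x + h) ^ 2))
      (cubeMeasure d) := fun h =>
    (integrable_potential_translate_mul B 0 1 h (by fun_prop)).const_mul _
  have hI2 : ∀ h : Fin d → ℝ, Integrable (fun x => 2 * (φ (x + h) - φ x) ^ 2) (cubeMeasure d) :=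
    fun h => integrable_of_continuous (by fun_prop)
  have hI : ∀ h : Fin d → ℝ, Integrable (fun x => 2 * (potential B 0 1 (x + h) * φ (x + h) ^ 2) +
      2 * (φ (x + h) - φ x) ^ 2) (cubeMeasure d) := fun h => (hI1 h).add (hI2 h)
  have hG0 : 0 ≤ ∫ x in unitCube d, ∑ i, partialDeriv i φ x ^ 2 :=
    integral_nonneg fun x => Finset.sum_nonneg fun i _ => sq_nonneg _
  have hterm : ∀ m ∈ offsets d L,
      ∫ x in unitCube d, (2 * (potential B 0 1 (x + shift m) * φ (x + shift m) ^ 2) +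
        2 * (φ (x + shift m) - φ x) ^ 2) ≤
      2 * (∫ x in unitCube d, potential B 0 1 x * φ x ^ 2) +
        2 * (d * (L : ℝ) ^ 2 / n ^ 2 * ∫ x in unitCube d, ∑ i, partialDeriv i φ x ^ 2) := by
    intro m hm
    rw [integral_add (hI1 _) (hI2 _), integral_const_mul, integral_const_mul]
    have hper : IsPeriodic fun x => potential B 0 1 x * φ x ^ 2 := fun x k => by
      simp only [isPeriodic_potential B 0 1 x k, hφ.2 x k]
    rw [integral_unitCube_translate hper (shift m)]
    have hs : ∑ i, shift m i ^ 2 ≤ d * (L : ℝ) ^ 2 / n ^ 2 := by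
      have hi : ∀ i, shift m i ^ 2 ≤ (L : ℝ) ^ 2 / n ^ 2 := by
        intro i
        have hmi : -(L : ℤ) ≤ m i ∧ m i ≤ L := Finset.mem_Icc.1 (Fintype.mem_piFinset.1 hm i)
        rw [hshift]
        dsimp only
        rw [div_pow]
        have h1 : -(L : ℝ) ≤ m i := by exact_mod_cast hmi.1
        have h2 : (m i : ℝ) ≤ L := by exact_mod_cast hmi.2
        gcongr ?_ / _
        exact sq_le_sq' h1 h2
      calc ∑ i, shift m i ^ 2 ≤ ∑ _i : Fin d, (L : ℝ) ^ 2 / n ^ 2 :=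
            Finset.sum_le_sum fun i _ => hi i
        _ = d * (L : ℝ) ^ 2 / n ^ 2 := by simp; ring
    gcongr
    exact (integral_sq_translate_sub_le hφ _).trans (mul_le_mul_of_nonneg_right hs hG0)
  have hsum : ∫ x in unitCube d, φ x ^ 2 ≤ (2 * L + 1) ^ d *
      (2 * (∫ x in unitCube d, potential B 0 1 x * φ x ^ 2) +
        2 * (d * (L : ℝ) ^ 2 / n ^ 2 * ∫ x in unitCube d, ∑ i, partialDeriv i φ x ^ 2)) := by
    refine (integral_mono (integrable_of_continuous (by fun_prop))
      (integrable_finsetSum _ fun m _ => hI (shift m)) hpt).trans ?_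
    rw [integral_finsetSum _ fun m _ => hI (shift m)]
    refine (Finset.sum_le_sum hterm).trans_eq ?_
    rw [Finset.sum_const, card_offsets, nsmul_eq_mul]
    push_cast
    ring
  calc _ ≤ (n : ℝ) ^ 2 * _ := mul_le_mul_of_nonneg_left hsum (by positivity)
    _ = _ := by field_simp

/-- The constant of the Friedrichs inequality. -/
def friedrichsConst (d : ℕ) (c₀ : ℝ) : ℝ := 3 ^ d * (2 / c₀ + 2 * d)

/-- The energy of a smooth function. -/
def smoothEnergy (B : Set (MeshIndex d n)) (α β : ℝ) (φ : (Fin d → ℝ) → ℝ) : ℝ :=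
  ∫ x in unitCube d, ((∑ i, partialDeriv i φ x ^ 2) + potential B α β x * φ x ^ 2)

lemma friedrichs_smooth [NeZero n] (hd : 1 ≤ d) {B : Set (MeshIndex d n)} (hB : B.Nonempty)
    {c₀ α β : ℝ} (hc₀ : 0 < c₀) (hα : 0 ≤ α) (hαβ : α ≤ β) (hβ : c₀ * (n : ℝ) ^ 2 ≤ β)
    {φ : (Fin d → ℝ) → ℝ} (hφ : IsSmoothPeriodic φ) :
    (n : ℝ) ^ 2 * ∫ x in unitCube d, φ x ^ 2 ≤
      friedrichsConst d c₀ * (valleyWidth B : ℝ) ^ (d + 2) * smoothEnergy B α β φ := by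
  have hc : Continuous φ := hφ.1.continuous
  have hcd := fun i => hφ.continuous_partialDeriv i
  have hL : (1 : ℝ) ≤ valleyWidth B := by exact_mod_cast one_le_valleyWidth B
  set L : ℝ := (valleyWidth B : ℝ)
  set G := ∫ x in unitCube d, ∑ i, partialDeriv i φ x ^ 2 with hG
  set W := ∫ x in unitCube d, potential B α β x * φ x ^ 2 with hW
  have hG0 : 0 ≤ G := integral_nonneg fun x => Finset.sum_nonneg fun i _ => sq_nonneg _
  have hW0 : 0 ≤ W := integral_nonneg fun x =>
    mul_nonneg (potential_nonneg B hα hαβ x) (sq_nonneg _)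
  have hE : smoothEnergy B α β φ = G + W := integral_add
    (integrable_of_continuous (by fun_prop))
    (integrable_potential_mul_continuous B α β (by fun_prop))
  -- `potential B 0 1` is the indicator of the `β`-region; there `c₀ n² ≤ β`, elsewhere `0 ≤ α`.
  have hBW : (n : ℝ) ^ 2 * ∫ x in unitCube d, potential B 0 1 x * φ x ^ 2 ≤ W / c₀ := by
    rw [le_div_iff₀ hc₀, hW, ← integral_const_mul, ← integral_mul_const]
    refine integral_mono
      (((integrable_potential_mul_continuous B 0 1 (by fun_prop)).const_mul _).mul_const _)
      (integrable_potential_mul_continuous B α β (by fun_prop)) fun x => ?_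
    have : (n : ℝ) ^ 2 * potential B 0 1 x * c₀ ≤ potential B α β x := by
      unfold potential
      split_ifs <;> linarith
    calc _ = ((n : ℝ) ^ 2 * potential B 0 1 x * c₀) * φ x ^ 2 := by ring
      _ ≤ _ := mul_le_mul_of_nonneg_right this (sq_nonneg _)
  calc _ ≤ (2 * L + 1) ^ d * (2 * n ^ 2 * (∫ x in unitCube d, potential B 0 1 x * φ x ^ 2) +
          2 * d * L ^ 2 * G) := integral_sq_le_of_smooth hd hB hφ
    -- Since `L ≥ 1`, `2L + 1 ≤ 3L`; this is the origin of `3^d` in `friedrichsConst`.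
    _ ≤ (3 * L) ^ d * (2 * (W / c₀) + 2 * d * L ^ 2 * G) := by
        have h0 : 0 ≤ ∫ x in unitCube d, potential B 0 1 x * φ x ^ 2 := integral_nonneg fun x =>
          mul_nonneg (potential_nonneg B le_rfl zero_le_one x) (sq_nonneg _)
        have h1 : 2 * L + 1 ≤ 3 * L := by linarith
        rw [mul_assoc 2]
        gcongr
    _ ≤ (3 * L) ^ d * ((2 / c₀ + 2 * d) * L ^ 2 * (G + W)) := by
        gcongr
        have h1 : W / c₀ ≤ L ^ 2 * (W / c₀) := le_mul_of_one_le_left (by positivity) (by nlinarith)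
        have h2 : 0 ≤ d * L ^ 2 * W := by positivity
        have h3 : 0 ≤ L ^ 2 * (G / c₀) := by positivity
        have : (2 / c₀ + 2 * d) * L ^ 2 * (G + W) = 2 * (L ^ 2 * (W / c₀)) + 2 * d * L ^ 2 * G +
          2 * (d * L ^ 2 * W) + 2 * (L ^ 2 * (G / c₀)) := by ring
        linarith
    _ = _ := by
        rw [hE, friedrichsConst, mul_pow]
        ring

end Friedrichs

/-! ### Smooth functions as elements of the energy space -/

section SmoothPairs

open Filter Topology

variable {d n : ℕ}

lemma exists_isGradPair {φ : (Fin d → ℝ) → ℝ} (hφ : IsSmoothPeriodic φ) :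
    ∃ p : FunGrad d, IsGradPair p φ := by
  have hL : ∀ f : (Fin d → ℝ) → ℝ, Continuous f → MemLp f 2 (cubeMeasure d) := fun f hf =>
    (memLp_two_iff_integrable_sq hf.aestronglyMeasurable).2
      (integrable_of_continuous (by fun_prop))
  refine ⟨WithLp.toLp 2 ((hL φ hφ.1.continuous).toLp φ, WithLp.toLp 2 fun i =>
    (hL _ (hφ.continuous_partialDeriv i)).toLp (partialDeriv i φ)), ?_, fun i => ?_⟩
  · exact (hL φ hφ.1.continuous).coeFn_toLp
  · exact (hL _ (hφ.continuous_partialDeriv i)).coeFn_toLp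

lemma IsGradPair.eq {p q : FunGrad d} {φ : (Fin d → ℝ) → ℝ} (hp : IsGradPair p φ)
    (hq : IsGradPair q φ) : p = q := by
  have h1 : p.fst = q.fst := Lp.ext (hp.1.trans hq.1.symm)
  have h2 : p.snd = q.snd := PiLp.ext fun i => Lp.ext ((hp.2 i).trans (hq.2 i).symm)
  exact (WithLp.ext_iff 2).2 (Prod.ext h1 h2)

lemma isGradPair_sum {ι : Type*} (s : Finset ι) {p : ι → FunGrad d} {φ : ι → (Fin d → ℝ) → ℝ}
    (hφ : ∀ j, IsSmoothPeriodic (φ j)) (hp : ∀ j, IsGradPair (p j) (φ j)) :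
    IsGradPair (∑ j ∈ s, p j) (fun x => ∑ j ∈ s, φ j x) := by
  have hsnd : ∀ i, (∑ j ∈ s, p j).snd i = ∑ j ∈ s, (p j).snd i := fun i =>
    map_sum ({ toFun := fun p : FunGrad d => p.snd i, map_zero' := rfl,
               map_add' := fun _ _ => rfl } : FunGrad d →+ L2 d) p s
  have hfst : (∑ j ∈ s, p j).fst = ∑ j ∈ s, (p j).fst :=
    map_sum ({ toFun := fun p : FunGrad d => p.fst, map_zero' := rfl,
               map_add' := fun _ _ => rfl } : FunGrad d →+ L2 d) p s
  refine ⟨?_, fun i => ?_⟩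
  · rw [hfst]
    refine (Lp.coeFn_fun_finsetSum _ _).trans ?_
    have : ∀ᵐ x ∂cubeMeasure d, ∀ j ∈ s, (p j).fst x = φ j x :=
      (ae_ball_iff s.countable_toSet).2 fun j _ => (hp j).1
    filter_upwards [this] with x hx
    exact Finset.sum_congr rfl hx
  · rw [hsnd]
    refine (Lp.coeFn_fun_finsetSum _ _).trans ?_
    have : ∀ᵐ x ∂cubeMeasure d, ∀ j ∈ s, (p j).snd i x = partialDeriv i (φ j) x :=
      (ae_ball_iff s.countable_toSet).2 fun j _ => (hp j).2 i
    filter_upwards [this] with x hx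
    rw [partialDeriv, fderiv_fun_sum fun j _ => (hφ j).1.differentiable (by simp) x,
      _root_.sum_apply]
    exact Finset.sum_congr rfl hx

lemma smoothPairs_univ_le : smoothPairs (d := d) Set.univ ≤ Hper d :=
  Submodule.le_topologicalClosure _

lemma mem_smoothPairs_univ {p : FunGrad d} {φ : (Fin d → ℝ) → ℝ} (hφ : IsSmoothPeriodic φ)
    (hp : IsGradPair p φ) : p ∈ smoothPairs (d := d) Set.univ :=
  ⟨φ, hφ, Set.subset_univ _, hp⟩

/-- A closed property that holds for smooth functions holds on all of `H¹_per(D)`. -/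
lemma Hper.induction_smooth {p : Hper d → Prop} (hp : IsClosed {u | p u})
    (h : ∀ (u : Hper d) (φ : (Fin d → ℝ) → ℝ), IsSmoothPeriodic φ → IsGradPair (u : FunGrad d) φ →
      p u) (u : Hper d) : p u := by
  have hu : u ∈ closure {v : Hper d | (v : FunGrad d) ∈ smoothPairs (d := d) Set.univ} := by
    rw [closure_subtype]
    refine closure_mono ?_ u.2
    intro q hq
    exact ⟨⟨q, smoothPairs_univ_le hq⟩, hq, rfl⟩
  refine closure_minimal ?_ hp hu
  rintro v ⟨φ, hφ, -, hv⟩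
  exact h v φ hφ hv

lemma energyForm_self_eq_smoothEnergy (B : Set (MeshIndex d n)) (α β : ℝ) {u : Hper d}
    {φ : (Fin d → ℝ) → ℝ} (hu : IsGradPair (u : FunGrad d) φ) :
    energyForm B α β u u = smoothEnergy B α β φ := by
  rw [energyForm_apply]
  refine integral_congr_ae ?_
  filter_upwards [hu.1, ae_all_iff.2 hu.2] with x h0 h1
  have h0' : fn u x = φ x := h0
  have h1' : ∀ i, pd i u x = partialDeriv i φ x := h1
  simp only [h0', h1', sq]

lemma energyForm_comm (B : Set (MeshIndex d n)) (α β : ℝ) (u v : Hper d) :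
    energyForm B α β u v = energyForm B α β v u := by
  rw [energyForm_apply, energyForm_apply]
  congr 1
  funext x
  simp only [mul_comm (fn u x), mul_comm (pd _ u x)]

lemma norm_sq_L2 (f : L2 d) : ‖f‖ ^ 2 = ∫ x in unitCube d, f x * f x := by
  rw [← real_inner_self_eq_norm_sq, L2.inner_def]
  rfl

lemma norm_sq_Hper (u : Hper d) : ‖u‖ ^ 2 = ‖fn u‖ ^ 2 + ∑ i, ‖pd i u‖ ^ 2 := by
  rw [Submodule.coe_norm, WithLp.prod_norm_sq_eq_of_L2, PiLp.norm_sq_eq_of_L2]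
  rfl

lemma energyForm_self_eq (B : Set (MeshIndex d n)) (α β : ℝ) (u : Hper d) :
    energyForm B α β u u =
      (∑ i, ‖pd i u‖ ^ 2) + ∫ x in unitCube d, potential B α β x * (fn u x * fn u x) := by
  rw [energyForm_apply, integral_add (integrable_finsetSum _ fun i _ => integrable_mul_L2 _ _)
    (integrable_potential_mul B α β _ _), integral_finsetSum _ fun i _ => integrable_mul_L2 _ _]
  simp only [norm_sq_L2]

lemma sum_norm_pd_sq_le (B : Set (MeshIndex d n)) {α β : ℝ} (hα : 0 ≤ α) (hαβ : α ≤ β)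
    (u : Hper d) : ∑ i, ‖pd i u‖ ^ 2 ≤ energyForm B α β u u := by
  rw [energyForm_self_eq]
  have : 0 ≤ ∫ x in unitCube d, potential B α β x * (fn u x * fn u x) :=
    integral_nonneg fun x => mul_nonneg (potential_nonneg B hα hαβ x) (mul_self_nonneg _)
  linarith

lemma energyForm_self_nonneg (B : Set (MeshIndex d n)) {α β : ℝ} (hα : 0 ≤ α) (hαβ : α ≤ β)
    (u : Hper d) : 0 ≤ energyForm B α β u u :=
  (Finset.sum_nonneg fun _ _ => sq_nonneg _).trans (sum_norm_pd_sq_le B hα hαβ u)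

lemma norm_fn_sq_eq {u : Hper d} {φ : (Fin d → ℝ) → ℝ} (hu : IsGradPair (u : FunGrad d) φ) :
    ‖fn u‖ ^ 2 = ∫ x in unitCube d, φ x ^ 2 := by
  rw [norm_sq_L2]
  refine integral_congr_ae ?_
  filter_upwards [hu.1] with x h0
  have h0' : fn u x = φ x := h0
  simp only [h0', sq]

/-- The Friedrichs inequality on `H¹_per(D)`. -/
lemma friedrichs [NeZero n] (hd : 1 ≤ d) {B : Set (MeshIndex d n)} (hB : B.Nonempty)
    {c₀ α β : ℝ} (hc₀ : 0 < c₀) (hα : 0 ≤ α) (hαβ : α ≤ β) (hβ : c₀ * (n : ℝ) ^ 2 ≤ β)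
    (u : Hper d) : (n : ℝ) ^ 2 * ‖fn u‖ ^ 2 ≤
      friedrichsConst d c₀ * (valleyWidth B : ℝ) ^ (d + 2) * energyForm B α β u u := by
  revert u
  refine Hper.induction_smooth ?_ fun u φ hφ hu => ?_
  · have : Continuous fun u : Hper d => fn u := by unfold fn; fun_prop
    exact isClosed_le (by fun_prop) (by fun_prop)
  · rw [norm_fn_sq_eq hu, energyForm_self_eq_smoothEnergy B α β hu]
    exact friedrichs_smooth hd hB hc₀ hα hαβ hβ hφ

lemma friedrichsConst_nonneg {c₀ : ℝ} (hc₀ : 0 < c₀) : 0 ≤ friedrichsConst d c₀ := by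
  unfold friedrichsConst
  positivity

/-- The energy form is coercive on `H¹_per(D)`. -/
lemma exists_coercive [NeZero n] (hd : 1 ≤ d) {B : Set (MeshIndex d n)} (hB : B.Nonempty)
    {c₀ α β : ℝ} (hc₀ : 0 < c₀) (hα : 0 ≤ α) (hαβ : α ≤ β) (hβ : c₀ * (n : ℝ) ^ 2 ≤ β) :
    ∃ c : ℝ, 0 < c ∧ ∀ u : Hper d, c * ‖u‖ * ‖u‖ ≤ energyForm B α β u u := by
  set F := friedrichsConst d c₀ * (valleyWidth B : ℝ) ^ (d + 2) with hF
  have hF0 : 0 ≤ F := mul_nonneg (friedrichsConst_nonneg hc₀) (by positivity)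
  -- As `n ≥ 1`, the function part of the norm is at most `F` times the energy, and the gradient
  -- part at most once the energy.
  refine ⟨(F + 1)⁻¹, by positivity, fun u => ?_⟩
  have h1 := friedrichs hd hB hc₀ hα hαβ hβ u
  have h2 := sum_norm_pd_sq_le B hα hαβ u
  have hn : (1 : ℝ) ≤ (n : ℝ) ^ 2 := one_le_pow₀ (by exact_mod_cast NeZero.one_le)
  have h3 : ‖fn u‖ ^ 2 ≤ (n : ℝ) ^ 2 * ‖fn u‖ ^ 2 := le_mul_of_one_le_left (sq_nonneg _) hn
  rw [mul_assoc, ← sq, inv_mul_le_iff₀ (by positivity), norm_sq_Hper]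
  linarith

/-! ### Local spaces -/

/-- A limit in `L²` of functions that vanish off `U` vanishes off `U`. -/
lemma isClosed_vanishing (U : Set (Fin d → ℝ)) :
    IsClosed {f : L2 d | ∀ᵐ x ∂cubeMeasure d, x ∉ U → f x = 0} := by
  refine IsSeqClosed.isClosed fun f g hf hfg => ?_
  obtain ⟨ns, -, hns⟩ := (tendstoInMeasure_of_tendsto_Lp hfg).exists_seq_tendsto_ae
  filter_upwards [hns, ae_all_iff.2 fun k => hf k] with x hx h0 hxU
  refine tendsto_nhds_unique hx ?_
  simp only [h0 _ hxU, tendsto_const_nhds_iff]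

/-- Smooth functions supported in the patch vanish off it together with their gradients, and this
survives `L²` limits. Elements of the abstract closure thereby become accessible to a pointwise
overlap count. -/
lemma localSpace_vanishing {z : MeshIndex d n} {w : Hper d} (hw : w ∈ localSpace z) :
    ∀ᵐ x ∂cubeMeasure d, x ∉ patch z → fn w x = 0 ∧ ∀ i, pd i w x = 0 := by
  have hw' : (w : FunGrad d) ∈ closure (smoothPairs (patch z) : Set (FunGrad d)) := hw
  have h0 : (w : FunGrad d) ∈ {p : FunGrad d |
      ∀ᵐ x ∂cubeMeasure d, x ∉ patch z → p.fst x = 0} := by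
    refine closure_minimal ?_ ((isClosed_vanishing (patch z)).preimage
      (f := fun p : FunGrad d => p.fst) (by fun_prop)) hw'
    rintro p ⟨φ, -, hφ, hp⟩
    filter_upwards [hp.1] with x hx hxU
    rw [hx]
    exact image_eq_zero_of_notMem_tsupport fun h => hxU (hφ h)
  have h1 : ∀ i, (w : FunGrad d) ∈ {p : FunGrad d |
      ∀ᵐ x ∂cubeMeasure d, x ∉ patch z → p.snd i x = 0} := by
    intro i
    refine closure_minimal ?_ ((isClosed_vanishing (patch z)).preimage
      (f := fun p : FunGrad d => p.snd i) (by fun_prop)) hw'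
    rintro p ⟨φ, -, hφ, hp⟩
    filter_upwards [hp.2 i] with x hx hxU
    rw [hx, partialDeriv, fderiv_of_notMem_tsupport ℝ fun h => hxU (hφ h)]
    rfl
  filter_upwards [h0, ae_all_iff.2 h1] with x h0 h1 hx
  exact ⟨h0 hx, fun i => h1 i hx⟩

lemma sq_sum_le_of_card_le {ι : Type*} [Fintype ι] (s : Finset ι) {N : ℝ} (hs : s.card ≤ N)
    {f : ι → ℝ} (hf : ∀ j ∉ s, f j = 0) : (∑ j, f j) ^ 2 ≤ N * ∑ j, f j ^ 2 := by
  rw [← Finset.sum_subset s.subset_univ fun j _ hj => hf j hj]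
  calc (∑ j ∈ s, f j) ^ 2 ≤ s.card * ∑ j ∈ s, f j ^ 2 := sq_sum_le_card_mul_sum_sq
    _ ≤ N * ∑ j, f j ^ 2 := by
        refine mul_le_mul hs ?_ (Finset.sum_nonneg fun _ _ => sq_nonneg _)
          ((Nat.cast_nonneg _).trans hs)
        exact Finset.sum_le_sum_of_subset_of_nonneg s.subset_univ fun _ _ _ => sq_nonneg _

/-- The patches have overlap `2^d`. -/
lemma energyForm_sum_le [NeZero n] (B : Set (MeshIndex d n)) {α β : ℝ} (hα : 0 ≤ α)
    (hαβ : α ≤ β) {w : MeshIndex d n → Hper d} (hw : ∀ z, w z ∈ localSpace z) :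
    energyForm B α β (∑ z, w z) (∑ z, w z) ≤ 2 ^ d * ∑ z, energyForm B α β (w z) (w z) := by
  classical
  simp only [energyForm_apply]
  have hint : ∀ z, Integrable (fun x => (∑ i, pd i (w z) x * pd i (w z) x) +
      potential B α β x * (fn (w z) x * fn (w z) x)) (cubeMeasure d) := fun z =>
    integrable_energyDensity B α β (w z) (w z)
  rw [← integral_finsetSum _ fun z _ => hint z, ← integral_const_mul]
  refine integral_mono_ae (integrable_energyDensity B α β _ _)
    ((integrable_finsetSum _ fun z _ => hint z).const_mul _) ?_
  have hfn : fn (∑ z, w z) = ∑ z, fn (w z) :=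
    map_sum ({ toFun := fn, map_zero' := rfl, map_add' := fun _ _ => rfl } : Hper d →+ L2 d) w _
  have hpd : ∀ i, pd i (∑ z, w z) = ∑ z, pd i (w z) := fun i =>
    map_sum ({ toFun := pd i, map_zero' := rfl, map_add' := fun _ _ => rfl } : Hper d →+ L2 d) w _
  have h0 : ∀ᵐ x ∂cubeMeasure d, fn (∑ z, w z) x = ∑ z, fn (w z) x := by
    rw [hfn]
    exact Lp.coeFn_fun_finsetSum _ _
  have h1 : ∀ᵐ x ∂cubeMeasure d, ∀ i, pd i (∑ z, w z) x = ∑ z, pd i (w z) x := by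
    refine ae_all_iff.2 fun i => ?_
    rw [hpd]
    exact Lp.coeFn_fun_finsetSum _ _
  filter_upwards [h0, h1, ae_all_iff.2 fun z => localSpace_vanishing (hw z)] with x h0 h1 hv
  rw [h0]
  simp only [h1, ← sq]
  -- At a fixed point only the patches in `s` contribute, so Cauchy–Schwarz costs `2^d` in each
  -- component; the nonnegative potential enters pointwise as a weight.
  set s := Finset.univ.filter fun z : MeshIndex d n => x ∈ patch z with hs
  have hcard : (s.card : ℝ) ≤ 2 ^ d := by
    exact_mod_cast card_patch_le s x fun z hz => (Finset.mem_filter.1 hz).2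
  have hns : ∀ z ∉ s, x ∉ patch z := fun z hz hx => hz (by simp [hs, hx])
  have e0 := sq_sum_le_of_card_le s hcard (f := fun z => fn (w z) x)
    fun z hz => (hv z (hns z hz)).1
  have e1 := fun i => sq_sum_le_of_card_le s hcard (f := fun z => pd i (w z) x)
    fun z hz => (hv z (hns z hz)).2 i
  calc _ ≤ (∑ i, 2 ^ d * ∑ z, pd i (w z) x ^ 2) +
        potential B α β x * (2 ^ d * ∑ z, fn (w z) x ^ 2) :=
        add_le_add (Finset.sum_le_sum fun i _ => e1 i)
          (mul_le_mul_of_nonneg_left e0 (potential_nonneg B hα hαβ x))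
    _ = _ := by
        rw [Finset.sum_add_distrib, Finset.sum_comm, ← Finset.mul_sum, ← Finset.mul_sum]
        rw [Finset.sum_comm]
        ring

end SmoothPairs

/-! ### The stable decomposition -/

section Decomposition

variable {d n : ℕ}

lemma IsSmoothPeriodic.mul {φ ψ : (Fin d → ℝ) → ℝ} (hφ : IsSmoothPeriodic φ)
    (hψ : IsSmoothPeriodic ψ) : IsSmoothPeriodic fun x => φ x * ψ x :=
  ⟨hφ.1.mul hψ.1, fun x k => by simp only [hφ.2, hψ.2]⟩

lemma IsSmoothPeriodic.partialDeriv_mul {φ ψ : (Fin d → ℝ) → ℝ} (hφ : IsSmoothPeriodic φ)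
    (hψ : IsSmoothPeriodic ψ) (i : Fin d) (x : Fin d → ℝ) :
    partialDeriv i (fun x => φ x * ψ x) x = φ x * partialDeriv i ψ x + ψ x * partialDeriv i φ x := by
  rw [partialDeriv, fderiv_fun_mul (hφ.1.differentiable (by simp) x)
    (hψ.1.differentiable (by simp) x)]
  rfl

lemma sq_partialDeriv_nodeBump_mul_le {M : ℝ} (hM0 : 0 ≤ M)
    (hM : ∀ t ∈ Set.Icc (0 : ℝ) 1, |deriv smoothStep t| ≤ M) (z : MeshIndex d n)
    {φ : (Fin d → ℝ) → ℝ} (hφ : IsSmoothPeriodic φ) (i : Fin d) (x : Fin d → ℝ) :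
    partialDeriv i (fun x => nodeBump z x * φ x) x ^ 2 ≤
      2 * partialDeriv i φ x ^ 2 + 2 * (n * M) ^ 2 * φ x ^ 2 := by
  rw [(isSmoothPeriodic_nodeBump z).partialDeriv_mul hφ]
  have h1 : nodeBump z x ^ 2 ≤ 1 := pow_le_one₀ (nodeBump_nonneg z x) (nodeBump_le_one z x)
  have h2 : partialDeriv i (nodeBump z) x ^ 2 ≤ (n * M) ^ 2 :=
    sq_le_sq' (neg_le_of_abs_le (abs_partialDeriv_nodeBump_le hM0 hM z i x))
      (le_of_abs_le (abs_partialDeriv_nodeBump_le hM0 hM z i x))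
  calc _ ≤ 2 * (nodeBump z x ^ 2 * partialDeriv i φ x ^ 2) +
        2 * (partialDeriv i (nodeBump z) x ^ 2 * φ x ^ 2) := by
        nlinarith [sq_nonneg (nodeBump z x * partialDeriv i φ x -
          φ x * partialDeriv i (nodeBump z) x)]
    _ ≤ 2 * (1 * partialDeriv i φ x ^ 2) + 2 * ((n * M) ^ 2 * φ x ^ 2) := by gcongr
    _ = _ := by ring

lemma tsupport_nodeBump_mul_subset [NeZero n] (z : MeshIndex d n) (φ : (Fin d → ℝ) → ℝ) :
    tsupport (fun x => nodeBump z x * φ x) ⊆ patch z :=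
  (tsupport_mul_subset_left (f := nodeBump z) (g := φ)).trans (tsupport_nodeBump_subset z)

/-- The energies of the localized pieces of a smooth function. -/
lemma sum_smoothEnergy_nodeBump_mul_le [NeZero n] (B : Set (MeshIndex d n)) {α β M : ℝ}
    (hα : 0 ≤ α) (hαβ : α ≤ β) (hM0 : 0 ≤ M)
    (hM : ∀ t ∈ Set.Icc (0 : ℝ) 1, |deriv smoothStep t| ≤ M) {φ : (Fin d → ℝ) → ℝ}
    (hφ : IsSmoothPeriodic φ) :
    ∑ z : MeshIndex d n, smoothEnergy B α β (fun x => nodeBump z x * φ x) ≤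
      2 ^ (d + 1) * (smoothEnergy B α β φ +
        d * M ^ 2 * ((n : ℝ) ^ 2 * ∫ x in unitCube d, φ x ^ 2)) := by
  classical
  have hint : ∀ {ψ : (Fin d → ℝ) → ℝ}, IsSmoothPeriodic ψ →
      Integrable (fun x => (∑ i, partialDeriv i ψ x ^ 2) + potential B α β x * ψ x ^ 2)
        (cubeMeasure d) := by
    intro ψ hψ
    have hc := hψ.1.continuous
    have hcd := fun i => hψ.continuous_partialDeriv i
    exact (integrable_of_continuous (by fun_prop)).add
      (integrable_potential_mul_continuous B α β (by fun_prop))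
  have hψ := fun z : MeshIndex d n => (isSmoothPeriodic_nodeBump z).mul hφ
  have hφc : Continuous φ := hφ.1.continuous
  have hI2 : Integrable (fun x => d * M ^ 2 * ((n : ℝ) ^ 2 * φ x ^ 2)) (cubeMeasure d) :=
    integrable_of_continuous (by fun_prop)
  unfold smoothEnergy
  rw [← integral_finsetSum _ fun z _ => hint (hψ z), ← integral_const_mul, ← integral_const_mul,
    ← integral_add (hint hφ) hI2, ← integral_const_mul]
  refine integral_mono (integrable_finsetSum _ fun z _ => hint (hψ z))
    (((hint hφ).add hI2).const_mul _) fun x => ?_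
  -- The constant `2^(d+1)` is the number `2^d` of patches over `x` times the factor `2` from
  -- squaring the product rule.
  set s := Finset.univ.filter fun z : MeshIndex d n => x ∈ patch z with hs
  have hcard : (s.card : ℝ) ≤ 2 ^ d := by
    exact_mod_cast card_patch_le s x fun z hz => (Finset.mem_filter.1 hz).2
  have hV := potential_nonneg B hα hαβ x
  set T := (∑ i, partialDeriv i φ x ^ 2) + potential B α β x * φ x ^ 2 +
    d * M ^ 2 * ((n : ℝ) ^ 2 * φ x ^ 2) with hT
  have hT0 : 0 ≤ T := by
    have : 0 ≤ ∑ i, partialDeriv i φ x ^ 2 := Finset.sum_nonneg fun _ _ => sq_nonneg _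
    positivity
  have hin : ∀ z ∈ s, (∑ i, partialDeriv i (fun x => nodeBump z x * φ x) x ^ 2) +
      potential B α β x * (nodeBump z x * φ x) ^ 2 ≤ 2 * T := by
    intro z _
    have h1 : ∑ i, partialDeriv i (fun x => nodeBump z x * φ x) x ^ 2 ≤
        2 * (∑ i, partialDeriv i φ x ^ 2) + 2 * (d * M ^ 2 * ((n : ℝ) ^ 2 * φ x ^ 2)) := by
      refine (Finset.sum_le_sum fun i _ =>
        sq_partialDeriv_nodeBump_mul_le hM0 hM z hφ i x).trans_eq ?_
      rw [Finset.sum_add_distrib, ← Finset.mul_sum]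
      simp only [Finset.sum_const, Finset.card_univ, Fintype.card_fin, nsmul_eq_mul]
      ring
    have h2 : (nodeBump z x * φ x) ^ 2 ≤ 2 * φ x ^ 2 := by
      have : nodeBump z x ^ 2 ≤ 1 := pow_le_one₀ (nodeBump_nonneg z x) (nodeBump_le_one z x)
      rw [mul_pow]
      nlinarith [sq_nonneg (φ x)]
    have h3 := mul_le_mul_of_nonneg_left h2 hV
    rw [hT]
    linarith
  have hout : ∀ z ∈ Finset.univ, z ∉ s →
      (∑ i, partialDeriv i (fun x => nodeBump z x * φ x) x ^ 2) +
        potential B α β x * (nodeBump z x * φ x) ^ 2 = 0 := by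
    intro z _ hz
    have hx : x ∉ tsupport fun x => nodeBump z x * φ x := fun h =>
      hz (by simp [hs, tsupport_nodeBump_mul_subset z φ h])
    have h0 : nodeBump z x * φ x = 0 :=
      image_eq_zero_of_notMem_tsupport (f := fun x => nodeBump z x * φ x) hx
    have h1 : ∀ i, partialDeriv i (fun x => nodeBump z x * φ x) x = 0 := fun i => by
      rw [partialDeriv, fderiv_of_notMem_tsupport ℝ hx]
      rfl
    simp [h0, h1]
  calc _ = ∑ z ∈ s, ((∑ i, partialDeriv i (fun x => nodeBump z x * φ x) x ^ 2) +
        potential B α β x * (nodeBump z x * φ x) ^ 2) :=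
        (Finset.sum_subset s.subset_univ hout).symm
    _ ≤ s.card • (2 * T) := Finset.sum_le_card_nsmul _ _ _ hin
    _ ≤ 2 ^ d * (2 * T) := by
        rw [nsmul_eq_mul]
        exact mul_le_mul_of_nonneg_right hcard (by positivity)
    _ = 2 ^ (d + 1) * T := by ring

/-- Smooth functions split into functions in the local spaces. -/
lemma exists_decomposition [NeZero n] (B : Set (MeshIndex d n)) {α β M : ℝ}
    (hα : 0 ≤ α) (hαβ : α ≤ β) (hM0 : 0 ≤ M)
    (hM : ∀ t ∈ Set.Icc (0 : ℝ) 1, |deriv smoothStep t| ≤ M) {φ : (Fin d → ℝ) → ℝ}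
    (hφ : IsSmoothPeriodic φ) {u : Hper d} (hu : IsGradPair (u : FunGrad d) φ) :
    ∃ w : MeshIndex d n → Hper d, (∀ z, w z ∈ localSpace z) ∧ ∑ z, w z = u ∧
      ∑ z, energyForm B α β (w z) (w z) ≤
        2 ^ (d + 1) * (energyForm B α β u u + d * M ^ 2 * ((n : ℝ) ^ 2 * ‖fn u‖ ^ 2)) := by
  have hψ := fun z : MeshIndex d n => (isSmoothPeriodic_nodeBump z).mul hφ
  choose p hp using fun z => exists_isGradPair (hψ z)
  refine ⟨fun z => ⟨p z, smoothPairs_univ_le (mem_smoothPairs_univ (hψ z) (hp z))⟩,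
    fun z => ?_, ?_, ?_⟩
  · exact Submodule.le_topologicalClosure (smoothPairs (patch z))
      ⟨_, hψ z, tsupport_nodeBump_mul_subset z φ, hp z⟩
  · refine Subtype.ext ?_
    rw [Submodule.coe_sum]
    refine (isGradPair_sum Finset.univ hψ hp).eq ?_
    have : (fun x => ∑ z : MeshIndex d n, nodeBump z x * φ x) = φ := by
      funext x
      rw [← Finset.sum_mul, sum_nodeBump, one_mul]
    rwa [this]
  · rw [norm_fn_sq_eq hu, energyForm_self_eq_smoothEnergy B α β hu]
    refine le_trans (le_of_eq ?_) (sum_smoothEnergy_nodeBump_mul_le B hα hαβ hM0 hM hφ)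
    exact Finset.sum_congr rfl fun z _ => energyForm_self_eq_smoothEnergy B α β (hp z)

end Decomposition

/-! ### Symmetric positive forms and Schwarz operators -/

section Abstract

variable {H : Type*} [NormedAddCommGroup H] [NormedSpace ℝ H]

/-- A symmetric operator with small quadratic form has small norm. -/
lemma form_apply_self_le {a : H →L[ℝ] StrongDual ℝ H} (hsymm : ∀ u v, a u v = a v u)
    (hpos : ∀ u, 0 ≤ a u u) {T : H →L[ℝ] H} (hT : ∀ u v, a (T u) v = a u (T v)) {γ : ℝ}
    (hγ : 0 ≤ γ) (h : ∀ u, |a (T u) u| ≤ γ * a u u) (v : H) :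
    √(a (T v) (T v)) ≤ γ * √(a v v) := by
  -- Polarisation: the bounds at `u + w` and `u - w` are subtracted and the parallelogram identity
  -- is used.
  have key : ∀ u w, 2 * a (T u) w ≤ γ * (a u u + a w w) := by
    intro u w
    have h1 := le_of_abs_le (h (u + w))
    have h2 := neg_le_of_abs_le (h (u - w))
    simp only [map_add, map_sub, add_apply, sub_apply] at h1 h2
    have h3 : a (T w) u = a (T u) w := by rw [hT, hsymm]
    linarith
  set x := √(a v v) with hx
  set y := √(a (T v) (T v)) with hy
  have hx2 : a v v = x ^ 2 := (Real.sq_sqrt (hpos v)).symm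
  have hy2 : a (T v) (T v) = y ^ 2 := (Real.sq_sqrt (hpos _)).symm
  have hx0 : 0 ≤ x := Real.sqrt_nonneg _
  have hy0 : 0 ≤ y := Real.sqrt_nonneg _
  have hst : ∀ s t : ℝ, 2 * (s * t * y ^ 2) ≤ γ * (s ^ 2 * x ^ 2 + t ^ 2 * y ^ 2) := by
    intro s t
    have := key (s • v) (t • T v)
    simp only [map_smul, smul_apply, smul_eq_mul, hx2, hy2] at this
    nlinarith
  rcases hy0.eq_or_lt with h0 | hy0
  · rw [← h0]
    positivity
  -- The choice `s = y`, `t = x` balances the right-hand side and gives `y ≤ γ x` after division by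
  -- `x * y²`.
  have := hst y x
  rcases hx0.eq_or_lt with h0 | hx0
  -- The form is only semidefinite here, so `x = 0` needs its own argument: if `y > 0`, this choice
  -- yields `2(γ+1)y² ≤ γy²`, which is absurd.
  · have h1 := hst (γ + 1) 1
    rw [← h0] at h1
    have : 0 < y ^ 2 := by positivity
    nlinarith
  · have h2 : x * y ^ 2 * y * (2 : ℝ) ≤ (x * y ^ 2) * (γ * x) * 2 := by nlinarith
    have h3 : 0 < x * y ^ 2 := by positivity
    nlinarith

/-- Coercivity is tested with `p - q`, which lies in `V`; this is the source of all uniqueness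
statements for the local operators. -/
lemma eq_of_form_eq {a : H →L[ℝ] StrongDual ℝ H} {c : ℝ} (hc : 0 < c)
    (ha : ∀ u, c * ‖u‖ * ‖u‖ ≤ a u u) {V : Submodule ℝ H} {p q : H} (hp : p ∈ V) (hq : q ∈ V)
    (h : ∀ v ∈ V, a p v = a q v) : p = q := by
  have h0 := ha (p - q)
  rw [map_sub a, sub_apply, h _ (V.sub_mem hp hq), sub_self] at h0
  by_contra hne
  have : 0 < ‖p - q‖ := norm_pos_iff.2 (sub_ne_zero.2 hne)
  have : 0 < c * ‖p - q‖ * ‖p - q‖ := by positivity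
  linarith

variable {ι : Type*} [Fintype ι]

/-- The spectral bounds for an additive Schwarz operator turn into an error reduction bound. -/
lemma form_sub_scaled_le {a : H →L[ℝ] StrongDual ℝ H} (hsymm : ∀ u v, a u v = a v u)
    (hpos : ∀ u, 0 ≤ a u u) {S : H →L[ℝ] H} (hS : ∀ u v, a (S u) v = a u (S v)) {K₁ K₂ : ℝ}
    (hK₁ : 0 < K₁) (hK₂ : 0 < K₂) (hlow : ∀ u, a u u ≤ K₁ * a (S u) u)
    (hup : ∀ u, a (S u) u ≤ K₂ * a u u) (v : H) :
    √(a ((.id ℝ H - (1 / (K₂ + K₁⁻¹)) • S) v) ((.id ℝ H - (1 / (K₂ + K₁⁻¹)) • S) v)) ≤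
      K₂ / (K₁⁻¹ + K₂) * √(a v v) := by
  set k := K₁⁻¹ with hk
  have hk0 : 0 < k := inv_pos.2 hK₁
  refine form_apply_self_le hsymm hpos (fun u v => ?_) (by positivity) (fun u => ?_) v
  · simp only [sub_apply, smul_apply, ContinuousLinearMap.id_apply, map_sub, map_smul,
      smul_eq_mul, hS]
  · simp only [sub_apply, smul_apply, ContinuousLinearMap.id_apply, map_sub, map_smul, smul_eq_mul]
    have h1 : k * a u u ≤ a (S u) u := by
      rw [hk, inv_mul_le_iff₀ hK₁]
      exact hlow u
    have h2 := hup u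
    have h3 := hpos u
    have e1 : a u u - 1 / (K₂ + k) * a (S u) u = ((K₂ + k) * a u u - a (S u) u) / (K₂ + k) := by
      field_simp
    have e2 : K₂ / (k + K₂) * a u u = (K₂ * a u u) / (K₂ + k) := by
      rw [add_comm k]
      ring
    rw [e1, e2, abs_div, abs_of_pos (show 0 < K₂ + k by positivity)]
    have hkK : k * a u u ≤ K₂ * a u u := h1.trans h2
    gcongr
    rw [abs_le]
    constructor <;> nlinarith

/-- Lower spectral bound for the sum of the local projections. -/
lemma form_le_of_decomposition {a : H →L[ℝ] StrongDual ℝ H} (hsymm : ∀ u v, a u v = a v u)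
    (hpos : ∀ u, 0 ≤ a u u) {V : ι → Submodule ℝ H} {P : ι → H →L[ℝ] H}
    (hP : ∀ z u, P z u ∈ V z ∧ ∀ v ∈ V z, a (P z u) v = a u v) {K : ℝ} (hK : 0 < K) {u : H}
    {w : ι → H} (hw : ∀ z, w z ∈ V z) (hsum : ∑ z, w z = u)
    (hle : ∑ z, a (w z) (w z) ≤ K * a u u) : a u u ≤ K * a ((∑ z, P z) u) u := by
  -- A weighted Young inequality, from expanding the form at `K • P z u - w z`. After summation the
  -- last terms contribute at most `a u u`, which is absorbed on the left.
  have hterm : ∀ z, 2 * a u (w z) ≤ K * a (P z u) u + K⁻¹ * a (w z) (w z) := by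
    intro z
    have h1 := hpos (K • P z u - w z)
    simp only [map_sub, map_smul, sub_apply, smul_apply, smul_eq_mul] at h1
    have h2 : a (P z u) (P z u) = a (P z u) u := by
      rw [(hP z u).2 _ (hP z u).1, hsymm]
    rw [hsymm (w z) (P z u), (hP z u).2 _ (hw z), h2] at h1
    have h3 : K * (2 * a u (w z)) ≤ K * (K * a (P z u) u + K⁻¹ * a (w z) (w z)) := by
      rw [mul_add, mul_inv_cancel_left₀ hK.ne']
      linarith
    exact le_of_mul_le_mul_left h3 hK
  have h1 : a u u = ∑ z, a u (w z) := by
    conv_lhs => rw [← hsum]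
    simp [← hsum]
  have h2 : a ((∑ z, P z) u) u = ∑ z, a (P z u) u := by
    simp [_root_.sum_apply, map_sum]
  have h3 := Finset.sum_le_sum fun z (_ : z ∈ Finset.univ) => hterm z
  rw [← Finset.mul_sum, Finset.sum_add_distrib, ← Finset.mul_sum, ← Finset.mul_sum, ← h1,
    ← h2] at h3
  have h4 : K⁻¹ * ∑ z, a (w z) (w z) ≤ a u u := by
    rwa [inv_mul_le_iff₀ hK]
  linarith

/-- Both sides equal `∑ z, a (P z u) (P z v)`. -/
lemma form_sum_projection_symm {a : H →L[ℝ] StrongDual ℝ H} (hsymm : ∀ u v, a u v = a v u)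
    {V : ι → Submodule ℝ H} {P : ι → H →L[ℝ] H}
    (hP : ∀ z u, P z u ∈ V z ∧ ∀ v ∈ V z, a (P z u) v = a u v) (u v : H) :
    a ((∑ z, P z) u) v = a u ((∑ z, P z) v) := by
  simp only [_root_.sum_apply, map_sum]
  refine Finset.sum_congr rfl fun z _ => ?_
  rw [hsymm, ← (hP z v).2 _ (hP z u).1, hsymm, (hP z u).2 _ (hP z v).1]

/-- Upper spectral bound for the sum of the local projections. -/
lemma form_sum_projection_le {a : H →L[ℝ] StrongDual ℝ H} (hsymm : ∀ u v, a u v = a v u)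
    (hpos : ∀ u, 0 ≤ a u u) {V : ι → Submodule ℝ H} {P : ι → H →L[ℝ] H}
    (hP : ∀ z u, P z u ∈ V z ∧ ∀ v ∈ V z, a (P z u) v = a u v) {K : ℝ} (hK : 0 < K)
    (hV : ∀ w : ι → H, (∀ z, w z ∈ V z) →
      a (∑ z, w z) (∑ z, w z) ≤ K * ∑ z, a (w z) (w z)) (u : H) :
    a ((∑ z, P z) u) u ≤ K * a u u := by
  have h1 : ∑ z, a (P z u) (P z u) = a ((∑ z, P z) u) u := by
    simp only [_root_.sum_apply, map_sum]
    refine Finset.sum_congr rfl fun z _ => ?_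
    rw [(hP z u).2 _ (hP z u).1, hsymm]
  have h2 := hV (fun z => P z u) fun z => (hP z u).1
  have h2' : a ((∑ z, P z) u) ((∑ z, P z) u) ≤ K * a ((∑ z, P z) u) u := by
    rw [h1] at h2
    simpa only [_root_.sum_apply] using h2
  -- With `S = ∑ z, P z`, nonnegativity gives `2K a(Su,u) ≤ a(Su,Su) + K² a(u,u)`; by overlap and
  -- the projection property `a(Su,Su) ≤ K a(Su,u)`.
  have h3 := hpos ((∑ z, P z) u - K • u)
  simp only [map_sub, map_smul, sub_apply, smul_apply, smul_eq_mul] at h3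
  rw [hsymm u] at h3
  have h4 : K * a ((∑ z, P z) u) u ≤ K * (K * a u u) := by linarith
  exact le_of_mul_le_mul_left h4 hK

end Abstract

/-! ### Solvability of coercive problems on closed subspaces. -/

section LaxMilgram

variable {H : Type*} [NormedAddCommGroup H] [InnerProductSpace ℝ H] [CompleteSpace H]

/-- A coercive form has a continuous solution operator. -/
lemma exists_rightInverse_of_isCoercive {b : H →L[ℝ] StrongDual ℝ H}
    (hb : IsCoercive b) : ∃ S : StrongDual ℝ H →L[ℝ] H, ∀ F, b (S F) = F := by
  obtain ⟨c, hc, hcb⟩ := hb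
  have hinj : b.ker = ⊥ := by
    refine LinearMap.ker_eq_bot'.2 fun v hv => ?_
    have hv' : b v = 0 := hv
    refine eq_of_form_eq hc hcb (Submodule.mem_top (x := v)) Submodule.mem_top fun w _ => ?_
    rw [hv', map_zero]
  have hsurj : b.range = ⊤ := by
    refine LinearMap.range_eq_top.2 fun F => ?_
    set e := IsCoercive.continuousLinearEquivOfBilin (B := b) ⟨c, hc, hcb⟩ with he
    set r := (InnerProductSpace.toDual ℝ H).symm F with hr
    refine ⟨e.symm r, ContinuousLinearMap.ext fun v => ?_⟩
    have h := IsCoercive.continuousLinearEquivOfBilin_apply (B := b) ⟨c, hc, hcb⟩ (e.symm r) v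
    rw [← he, e.apply_symm_apply, hr, InnerProductSpace.toDual_symm_apply] at h
    exact h.symm
  exact ⟨(ContinuousLinearEquiv.ofBijective b hinj hsurj).symm,
    (ContinuousLinearEquiv.ofBijective b hinj hsurj).apply_symm_apply⟩

/-- Continuous solution operator on a closed subspace for a coercive form. -/
lemma exists_solver {a : H →L[ℝ] StrongDual ℝ H} {c : ℝ} (hc : 0 < c)
    (ha : ∀ u, c * ‖u‖ * ‖u‖ ≤ a u u) {V : Submodule ℝ H} (hV : IsClosed (V : Set H)) :
    ∃ R : StrongDual ℝ H →L[ℝ] H, ∀ F, R F ∈ V ∧ ∀ v ∈ V, a (R F) v = F v := by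
  have : CompleteSpace V := hV.completeSpace_coe
  set res : StrongDual ℝ H →L[ℝ] StrongDual ℝ V :=
    -- Restriction of functionals from `H` to `V`, used both for the data and to compress the form.
    (ContinuousLinearMap.compL ℝ V H ℝ).flip V.subtypeL
  obtain ⟨S, hS⟩ := exists_rightInverse_of_isCoercive (b := res.comp (a.comp V.subtypeL))
    ⟨c, hc, fun v => ha v⟩
  refine ⟨V.subtypeL.comp (S.comp res), fun F => ⟨Subtype.coe_prop _, fun v hv => ?_⟩⟩
  exact DFunLike.congr_fun (hS (res F)) (⟨v, hv⟩ : V)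

end LaxMilgram

/-! ### Convergence of the preconditioned iteration -/

section Main

variable {d n : ℕ}

instance : CompleteSpace (Hper d) :=
  (Submodule.isClosed_topologicalClosure _).completeSpace_coe

lemma isClosed_localSpace (z : MeshIndex d n) : IsClosed (localSpace z : Set (Hper d)) :=
  (Submodule.isClosed_topologicalClosure (smoothPairs (patch z))).preimage continuous_subtype_val

lemma exists_isLocalSolver (B : Set (MeshIndex d n)) {α β c : ℝ} (hc : 0 < c)
    (ha : ∀ u : Hper d, c * ‖u‖ * ‖u‖ ≤ energyForm B α β u u) (z : MeshIndex d n) :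
    ∃ R, IsLocalSolver B α β z R := by
  have h := @exists_solver (Hper d) _ _ _ (energyForm B α β) c hc
  obtain ⟨R, hR⟩ := h ha (isClosed_localSpace z)
  exact ⟨R, hR⟩

lemma existsUnique_isLocalSolver (B : Set (MeshIndex d n)) {α β c : ℝ} (hc : 0 < c)
    (ha : ∀ u : Hper d, c * ‖u‖ * ‖u‖ ≤ energyForm B α β u u) (z : MeshIndex d n) :
    ∃! R, IsLocalSolver B α β z R := by
  obtain ⟨R, hR⟩ := exists_isLocalSolver B hc ha z
  refine ⟨R, hR, fun R' hR' => ContinuousLinearMap.ext fun F => ?_⟩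
  exact eq_of_form_eq hc ha (hR' F).1 (hR F).1 fun v hv => by rw [(hR' F).2 v hv, (hR F).2 v hv]

lemma existsUnique_isLocalProjection (B : Set (MeshIndex d n)) {α β c : ℝ} (hc : 0 < c)
    (ha : ∀ u : Hper d, c * ‖u‖ * ‖u‖ ≤ energyForm B α β u u) (z : MeshIndex d n) :
    ∃! P, IsLocalProjection B α β z P := by
  obtain ⟨R, hR⟩ := exists_isLocalSolver B hc ha z
  refine ⟨R.comp (energyForm B α β), fun u => hR (energyForm B α β u), fun P' hP' =>
    ContinuousLinearMap.ext fun u => ?_⟩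
  exact eq_of_form_eq hc ha (hP' u).1 (hR _).1 fun v hv =>
    ((hP' u).2 v hv).trans ((hR (energyForm B α β u)).2 v hv).symm

/-- Vectors of zero energy cause no trouble: the bound forces the numerator to vanish too, and `0 /
0 = 0`. -/
lemma energyOpNorm_le {B : Set (MeshIndex d n)} {α β γ : ℝ} {T : Hper d →L[ℝ] Hper d}
    (hT : ∀ v, energyNorm B α β (T v) ≤ γ * energyNorm B α β v) (hγ : 0 ≤ γ) :
    energyOpNorm B α β T ≤ ENNReal.ofReal γ := by
  refine iSup_le fun v => ENNReal.div_le_of_le_mul ?_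
  rw [← ENNReal.ofReal_mul hγ]
  exact ENNReal.ofReal_le_ofReal (hT v)

lemma K₁_pos (C : ℝ) (B : Set (MeshIndex d n)) : 0 < K₁ C B := by
  unfold K₁
  positivity

lemma K₂_pos (d : ℕ) : 0 < K₂ d := by
  unfold K₂
  positivity

/-- The lower spectral bound for the sum of the local projections. -/
lemma energyForm_le_K₁_mul [NeZero n] (hd : 1 ≤ d) {B : Set (MeshIndex d n)} (hB : B.Nonempty)
    {c₀ α β M C : ℝ} (hc₀ : 0 < c₀) (hα : 0 ≤ α) (hαβ : α ≤ β) (hβ : c₀ * (n : ℝ) ^ 2 ≤ β)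
    (hM0 : 0 ≤ M) (hM : ∀ t ∈ Set.Icc (0 : ℝ) 1, |deriv smoothStep t| ≤ M)
    (hC : d * M ^ 2 * friedrichsConst d c₀ ≤ C ^ 2)
    {P : MeshIndex d n → Hper d →L[ℝ] Hper d} (hP : ∀ z, IsLocalProjection B α β z (P z))
    (u : Hper d) :
    energyForm B α β u u ≤ K₁ C B * energyForm B α β ((∑ z, P z) u) u := by
  revert u
  -- Both sides are continuous in `u` and the operators `P` are fixed, so only smooth functions need
  -- to be decomposed.
  refine Hper.induction_smooth (isClosed_le (by fun_prop) (by fun_prop)) fun u φ hφ hu => ?_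
  obtain ⟨w, hw, hsum, hle⟩ := exists_decomposition B hα hαβ hM0 hM hφ hu
  refine form_le_of_decomposition (energyForm_comm B α β) (energyForm_self_nonneg B hα hαβ) hP
    (K₁_pos C B) hw hsum (hle.trans ?_)
  have hL : (1 : ℝ) ≤ valleyWidth B := by exact_mod_cast one_le_valleyWidth B
  have hκ : (1 : ℝ) ≤ valleyOverlap B := by exact_mod_cast one_le_valleyOverlap B
  have hE := energyForm_self_nonneg B hα hαβ u
  have hF := friedrichs hd hB hc₀ hα hαβ hβ u
  rw [K₁, mul_assoc (2 ^ (d + 1) : ℝ)]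
  refine mul_le_mul_of_nonneg_left ?_ (by positivity)
  set L := (valleyWidth B : ℝ)
  set κ := (valleyOverlap B : ℝ)
  -- The Friedrichs constant grows only like `L^(d+2)`; `κ ≥ 1` and `L ≥ 1` enlarge it to the form
  -- `κ² L^(2d) L²` prescribed by `K₁`.
  have h1 : L ^ (d + 2) ≤ κ ^ 2 * (L ^ d) ^ 2 * L ^ 2 := by
    calc L ^ (d + 2) = 1 * (1 * L ^ d) * L ^ 2 := by ring
      _ ≤ κ ^ 2 * (L ^ d * L ^ d) * L ^ 2 := by
          gcongr
          · exact one_le_pow₀ hκ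
          · exact one_le_pow₀ hL
      _ = κ ^ 2 * (L ^ d) ^ 2 * L ^ 2 := by ring
  calc energyForm B α β u u + d * M ^ 2 * ((n : ℝ) ^ 2 * ‖fn u‖ ^ 2)
      ≤ energyForm B α β u u +
          d * M ^ 2 * (friedrichsConst d c₀ * L ^ (d + 2) * energyForm B α β u u) := by gcongr
    _ = energyForm B α β u u +
          (d * M ^ 2 * friedrichsConst d c₀) * L ^ (d + 2) * energyForm B α β u u := by ring
    _ ≤ energyForm B α β u u +
          C ^ 2 * (κ ^ 2 * (L ^ d) ^ 2 * L ^ 2) * energyForm B α β u u := by gcongr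
    _ = _ := by ring

end Main

end Schroedinger

end

theorem mainTheorem1 (d : ℕ) (hd : 1 ≤ d) (c₀ : ℝ) (hc₀ : 0 < c₀) :
    ∃ C : ℝ, 0 < C ∧
      ∀ (n : ℕ) [NeZero n] (B : Set (Schroedinger.MeshIndex d n)), B.Nonempty →
        Schroedinger.valleyOverlap B ≤ Schroedinger.valleyWidth B ^ d ∧
        ∃ γ : ℝ, 0 < γ ∧ γ < 1 ∧
          γ ≤ Schroedinger.K₂ d / ((Schroedinger.K₁ C B)⁻¹ + Schroedinger.K₂ d) ∧
          ∀ α β : ℝ, 0 ≤ α → α ≤ β → c₀ * (n : ℝ) ^ 2 ≤ β →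
            (∀ z, ∃! Pz, Schroedinger.IsLocalProjection B α β z Pz) ∧
            (∀ z, ∃! Rz, Schroedinger.IsLocalSolver B α β z Rz) ∧
            ∀ (P : Schroedinger.MeshIndex d n → (Schroedinger.Hper d →L[ℝ] Schroedinger.Hper d))
              (R : Schroedinger.MeshIndex d n →
                (StrongDual ℝ (Schroedinger.Hper d) →L[ℝ] Schroedinger.Hper d)),
              (∀ z, Schroedinger.IsLocalProjection B α β z (P z)) →
              (∀ z, Schroedinger.IsLocalSolver B α β z (R z)) →
              Schroedinger.energyOpNorm B α β
                  (.id ℝ _ - Schroedinger.scaling C B • ∑ z, P z) =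
                Schroedinger.energyOpNorm B α β
                  (.id ℝ _ - Schroedinger.scaling C B •
                    ((∑ z, R z).comp (Schroedinger.energyForm B α β))) ∧
              Schroedinger.energyOpNorm B α β
                  (.id ℝ _ - Schroedinger.scaling C B • ∑ z, P z) ≤ ENNReal.ofReal γ := by
  open Schroedinger in
  obtain ⟨M, hM0, hM⟩ := exists_abs_deriv_smoothStep_le
  have hF : 0 ≤ d * M ^ 2 * friedrichsConst d c₀ :=
    mul_nonneg (by positivity) (friedrichsConst_nonneg hc₀)
  -- The summand `1` ensures that `C` is positive and that `C²` dominates the constant without it.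
  refine ⟨d * M ^ 2 * friedrichsConst d c₀ + 1, by positivity, fun n _ B hB =>
    ⟨valleyOverlap_le B, ?_⟩⟩
  set C := d * M ^ 2 * friedrichsConst d c₀ + 1 with hC
  have hK₁ := K₁_pos C B
  have hK₂ := K₂_pos d
  refine ⟨K₂ d / ((K₁ C B)⁻¹ + K₂ d), by positivity, ?_, le_rfl, fun α β hα hαβ hβ => ?_⟩
  · rw [div_lt_one (by positivity)]
    exact lt_add_of_pos_left _ (inv_pos.2 hK₁)
  obtain ⟨c, hc, ha⟩ := exists_coercive hd hB hc₀ hα hαβ hβ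
  refine ⟨existsUnique_isLocalProjection B hc ha, existsUnique_isLocalSolver B hc ha,
    fun P R hP hR => ⟨?_, ?_⟩⟩
  -- Both `P z u` and `R z (energyForm B α β u)` solve the same coercive local problem, so the two
  -- preconditioned operators coincide.
  · have hPR : ∑ z, P z = (∑ z, R z).comp (energyForm B α β) := by
      refine ContinuousLinearMap.ext fun u => ?_
      simp only [ContinuousLinearMap.comp_apply, sum_apply]
      refine Finset.sum_congr rfl fun z _ => ?_
      exact eq_of_form_eq hc ha (hP z u).1 (hR z _).1 fun v hv => by
        rw [(hP z u).2 v hv, (hR z _).2 v hv]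
    rw [hPR]
  · have hsymm := energyForm_comm B α β
    have hpos := energyForm_self_nonneg B hα hαβ
    refine energyOpNorm_le (form_sub_scaled_le hsymm hpos (form_sum_projection_symm hsymm hP)
      hK₁ hK₂ ?_ ?_) (by positivity)
    · exact energyForm_le_K₁_mul hd hB hc₀ hα hαβ hβ hM0 hM (by nlinarith) hP
    · exact form_sum_projection_le hsymm hpos hP hK₂ fun w hw => energyForm_sum_le B hα hαβ hw
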